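/- **Setting.** A metric space $T$ is a *real tree* if any two points $u,v$ are joined by a unique isometric embedding $\phi_{u,v}:[0,d(u,v)]\to T$ with $\phi_{u,v}(0)=u$, $\phi_{u,v}(d(u,v))=v$, and every injective continuous $\kappa:[0,1]\to T$ satisfies $\kappa([0,1])=\phi_{\kappa(0),\kappa(1)}([0,d(\kappa(0),\kappa(1))])$. Let $(X,d)$ be a locally compact, connected, separable metric space which is a *uniform local tree*: every ball $B(x,\iota(x))$, $x\in X$, is a real tree, where $\iota:X\to(0,\infty)$ satisfies $\iota\ge\underline\iota$ for some constant $0<\underline\iota\le\operatorname{diam}(X)$. Let $m$ be a Radon measure on $X$ with full support. Let $r_0>0$, $\alpha\ge1$, and let $\Phi:[0,r_0]\to[0,\infty)$ be nondecreasing, such that for some constants $c_0,C_0,c_1,C_1>0$ $$c_0\frac Rr\le\frac{\Phi(R)}{\Phi(r)}\le C_0\Big(\frac Rr\Big)^{\alpha}\quad(0<r\le R\le r_0),\qquad c_1\Phi(r)\le m(B(x,r))\le C_1\Phi(r)\quad(x\in X,\ 0<r<r_0).$$ For $d(x,y)<\iota(x)$ let $]x,y[$ be the open geodesic segment from $x$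 to $y$; let $\mathcal S=\bigcup_{d(x,y)<\iota(x)}]x,y[$ be the skeleton and let $\nu$ be the length measure on $\mathcal S$, i.e. the measure with $\nu(]x,y[)=d(x,y)$ whenever $d(x,y)<\iota(x)$ (equivalently, one-dimensional Hausdorff measure restricted to $\mathcal S$). A continuous $f:X\to\mathbb R$ is *absolutely continuous*, $f\in AC(X)$, if for every $x\in X$ there is a function $\partial_xf$ on $\mathcal S\cap B(x,\iota(x))$, integrable on the segments $]x,u[$, with $f(u)-f(x)=\int_{]x,u[}\partial_xf\,d\nu$ for all $u\in B(x,\iota(x))$; $|\partial f|$ denotes the function on $\mathcal S$ that agrees $\nu$-a.e. with $|\partial_xf|$ on each $B(x,\iota(x))$. Let $W^{1,1}(X,m)$ be the set of $f\in L^1(X,m)$ that have a (necessarily unique) representative in $AC(X)$ with $|\partial f|\in L^1(\mathcal S,\nu)$, and for $f\in L^1(X,m)$ let $$\|\partial f\|(X)=\inf\Big\{\liminf_{n\to\infty}\int_{\mathcal S}|\partial f_n|\,d\nu\;:\;f_n\in W^{1,1}(X,m),\ f_n\to f\text{ in }L^1(X,m)\Big\},$$ $$BV(X,m)=\{f\in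 L^1(X,m):\|\partial f\|(X)<\infty\}.$$ With $\Psi_1=\Phi$, let $$E_{1,\Psi_1}(f,r)=\frac1{\Psi_1(r)}\int_X\frac1{m(B(x,r))}\int_{B(x,r)}|f(y)-f(x)|\,dm(y)\,dm(x),$$ $$KS^{\Psi_1,1}(X,m)=\Big\{f\in L^1(X,m):\limsup_{r\to0}E_{1,\Psi_1}(f,r)<\infty\Big\}.$$ **Theorem.** $KS^{\Psi_1,1}(X,m)=BV(X,m)$, and there exist constants $c,C>0$ and $r_1\in(0,r_0]$ such that for every $f\in KS^{\Psi_1,1}(X,m)$ $$c\sup_{r\in(0,r_1]}E_{1,\Psi_1}(f,r)\le\|\partial f\|(X)\le C\liminf_{r\to0}E_{1,\Psi_1}(f,r).$$ -/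

import Mathlib

open MeasureTheory Set Filter Topology Metric
open scoped ENNReal

noncomputable section

namespace LocalTree

/-- `φ`, restricted to `[0, d(x, y)]`, is an isometric embedding with `φ 0 = x` and
`φ (d(x, y)) = y`. The values of `φ` outside `[0, d(x, y)]` are irrelevant. -/
structure IsGeodesic {X : Type*} [MetricSpace X] (φ : ℝ → X) (x y : X) : Prop where
  map_zero : φ 0 = x
  map_dist : φ (dist x y) = y
  dist_map : ∀ s ∈ Icc (0 : ℝ) (dist x y), ∀ t ∈ Icc (0 : ℝ) (dist x y),
    dist (φ s) (φ t) = |s - t|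

/-- Real trees: unique geodesics, and every injective continuous path traces out the geodesic
between its endpoints. -/
structure IsRealTree (T : Type*) [MetricSpace T] : Prop where
  unique_geodesic : ∀ u v : T, ∃ φ : ℝ → T, IsGeodesic φ u v ∧
    ∀ ψ : ℝ → T, IsGeodesic ψ u v → EqOn ψ φ (Icc 0 (dist u v))
  loop_free : ∀ κ : ℝ → T, ContinuousOn κ (Icc 0 1) → InjOn κ (Icc 0 1) →
    ∀ φ : ℝ → T, IsGeodesic φ (κ 0) (κ 1) →
      κ '' Icc 0 1 = φ '' Icc 0 (dist (κ 0) (κ 1))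

/-- The open segment `]x, y[`. It is used only for `d(x, y) < ι(x)` with `B(x, ι(x))` a real
tree; every geodesic of `X` from `x` to `y` then stays in that ball, so it exists and is unique. -/
def openSeg {X : Type*} [MetricSpace X] (x y : X) : Set X :=
  {z | ∃ φ : ℝ → X, IsGeodesic φ x y ∧ ∃ t ∈ Ioo (0 : ℝ) (dist x y), φ t = z}

/-- The skeleton: the union of the open segments `]x, y[` with `d(x, y) < ι(x)`. -/
def skeleton {X : Type*} [MetricSpace X] (ι : X → ℝ) : Set X :=
  ⋃ x : X, ⋃ y ∈ ball x (ι x), openSeg x y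

/-- The length measure `ν`, as a Borel measure on `X` carried by the skeleton: the
one-dimensional Hausdorff measure restricted to the skeleton. By `lengthMeasure_openSeg` it gives
each open segment `]x, y[` with `d(x, y) < ι(x)` the mass `d(x, y)`. -/
def lengthMeasure {X : Type*} [MetricSpace X] [MeasurableSpace X] [BorelSpace X]
    (ι : X → ℝ) : Measure X :=
  (Measure.hausdorffMeasure 1).restrict (skeleton ι)

/-- `g` is the weak gradient `∂ₓ f` of `f` in `B(x, ι(x))`: it is integrable along the segments
issued from `x`, and `f(u) - f(x) = ∫_{]x,u[} g dν` for all `u ∈ B(x, ι(x))`. -/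
def IsWeakGradientAt {X : Type*} [MetricSpace X] [MeasurableSpace X] [BorelSpace X]
    (ι : X → ℝ) (f : X → ℝ) (x : X) (g : X → ℝ) : Prop :=
  ∀ u ∈ ball x (ι x), IntegrableOn g (openSeg x u) (lengthMeasure ι) ∧
    f u - f x = ∫ z in openSeg x u, g z ∂(lengthMeasure ι)

/-- The class `AC(X)` of absolutely continuous functions. -/
def IsAC {X : Type*} [MetricSpace X] [MeasurableSpace X] [BorelSpace X]
    (ι : X → ℝ) (f : X → ℝ) : Prop :=
  Continuous f ∧ ∀ x, ∃ g, IsWeakGradientAt ι f x g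

/-- `h` is (a version of) `|∂f|`: on each `B(x, ι(x))` it agrees `ν`-a.e. with `|∂ₓ f|`.
As weak gradients are unique up to `ν`-null sets, `h` is unique up to `ν`-null sets. -/
def IsAbsGradient {X : Type*} [MetricSpace X] [MeasurableSpace X] [BorelSpace X]
    (ι : X → ℝ) (f : X → ℝ) (h : X → ℝ) : Prop :=
  AEStronglyMeasurable h (lengthMeasure ι) ∧
    ∀ x, ∃ g, IsWeakGradientAt ι f x g ∧
      ∀ᵐ z ∂((lengthMeasure ι).restrict (ball x (ι x))), h z = |g z|

/-- `∫_𝒮 |∂f| dν` for `f ∈ AC(X)`. The infimum over the versions `h` of `|∂f|` only serves to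
select the common value of the integrals. -/
def gradIntegral {X : Type*} [MetricSpace X] [MeasurableSpace X] [BorelSpace X]
    (ι : X → ℝ) (f : X → ℝ) : ℝ≥0∞ :=
  ⨅ (h : X → ℝ) (_ : IsAbsGradient ι f h), ∫⁻ z, ‖h z‖ₑ ∂(lengthMeasure ι)

/-- The Sobolev space `W^{1,1}(X, m)`: classes in `L¹(X, m)` having a representative in `AC(X)`
whose weak gradient is in `L¹(𝒮, ν)`. -/
def sobolevSpace {X : Type*} [MetricSpace X] [MeasurableSpace X] [BorelSpace X]
    (m : Measure X) (ι : X → ℝ) : Set (Lp ℝ 1 m) :=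
  {f | ∃ f' : X → ℝ, f' =ᵐ[m] f ∧ IsAC ι f' ∧
    ∃ h, IsAbsGradient ι f' h ∧ MemLp h 1 (lengthMeasure ι)}

/-- `∫_𝒮 |∂f| dν` for `f ∈ W^{1,1}(X, m)`, computed on the representative in `AC(X)` (which is
unique as `m` has full support). -/
def energyOne {X : Type*} [MetricSpace X] [MeasurableSpace X] [BorelSpace X]
    (m : Measure X) (ι : X → ℝ) (f : Lp ℝ 1 m) : ℝ≥0∞ :=
  ⨅ (f' : X → ℝ) (_ : f' =ᵐ[m] f ∧ IsAC ι f'), gradIntegral ι f'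

/-- The total variation `‖∂f‖(X)`: the `L¹`-relaxation of `f ↦ ∫_𝒮 |∂f| dν`. -/
def totalVariation {X : Type*} [MetricSpace X] [MeasurableSpace X] [BorelSpace X]
    (m : Measure X) (ι : X → ℝ) (f : Lp ℝ 1 m) : ℝ≥0∞ :=
  ⨅ (F : ℕ → Lp ℝ 1 m) (_ : (∀ n, F n ∈ sobolevSpace m ι) ∧ Tendsto F atTop (𝓝 f)),
    liminf (fun n => energyOne m ι (F n)) atTop

/-- The space `BV(X, m)`. -/
def BVSpace {X : Type*} [MetricSpace X] [MeasurableSpace X] [BorelSpace X]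
    (m : Measure X) (ι : X → ℝ) : Set (Lp ℝ 1 m) :=
  {f | totalVariation m ι f < ∞}

/-- `Ψ_p(r) = r^{p-1} Φ(r)`. -/
def scalePsi (Φ : ℝ → ℝ) (p : ℝ) (r : ℝ) : ℝ := r ^ (p - 1) * Φ r

/-- The Korevaar-Schoen functional `E_{p,Ψ_p}(f, r)`. -/
def ksEnergy {X : Type*} [MetricSpace X] [MeasurableSpace X]
    (m : Measure X) (Φ : ℝ → ℝ) (p : ℝ) (f : X → ℝ) (r : ℝ) : ℝ≥0∞ :=
  (ENNReal.ofReal (scalePsi Φ p r))⁻¹ *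
    ∫⁻ x, (m (ball x r))⁻¹ * ∫⁻ y in ball x r, ‖f y - f x‖ₑ ^ p ∂m ∂m

/-- The Korevaar-Schoen space `KS^{Ψ_1,1}(X, m)`. -/
def KSSpace {X : Type*} [MetricSpace X] [MeasurableSpace X]
    (m : Measure X) (Φ : ℝ → ℝ) : Set (Lp ℝ 1 m) :=
  {f | limsup (fun r => ksEnergy m Φ 1 f r) (𝓝[>] 0) < ∞}

/-- The length measure of `]x, y[` is `d(x, y)` when `d(x, y) < ι(x)` and `B(x, ι(x))` is a real
tree. -/
theorem lengthMeasure_openSeg {X : Type*} [MetricSpace X] [MeasurableSpace X] [BorelSpace X]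
    (ι : X → ℝ) (x y : X) (hy : y ∈ ball x (ι x)) (ht : IsRealTree (ball x (ι x))) :
    lengthMeasure ι (openSeg x y) = ENNReal.ofReal (dist x y) := by
  have hxy : dist x y < ι x := by rw [dist_comm]; exact hy
  have hx : x ∈ ball x (ι x) := mem_ball_self (dist_nonneg.trans_lt hxy)
  obtain ⟨φ, hφ, huniq⟩ := ht.unique_geodesic ⟨x, hx⟩ ⟨y, hy⟩
  have hd : dist (⟨x, hx⟩ : ball x (ι x)) ⟨y, hy⟩ = dist x y := rfl
  have hφ2 : IsGeodesic (fun t => (φ t : X)) x y :=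
    ⟨by simp [hφ.map_zero], by have := hφ.map_dist; rw [hd] at this; simp [this],
      fun s hs t ht => hφ.dist_map s hs t ht⟩
  have heq : openSeg x y = (fun t => (φ t : X)) '' Ioo 0 (dist x y) := by
    ext z
    constructor
    · rintro ⟨ψ, hψ, t, ht, rfl⟩
      classical
      have hmem : ∀ s ∈ Icc (0 : ℝ) (dist x y), ψ s ∈ ball x (ι x) := by
        intro s hs
        have h1 := hψ.dist_map s hs 0 ⟨le_rfl, dist_nonneg⟩
        rw [hψ.map_zero, sub_zero, abs_of_nonneg hs.1] at h1
        rw [mem_ball, h1]; exact hs.2.trans_lt hxy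
      let ψ' : ℝ → ball x (ι x) := fun s =>
        if hs : s ∈ Icc (0 : ℝ) (dist x y) then ⟨ψ s, hmem s hs⟩ else ⟨x, hx⟩
      have hval : ∀ s ∈ Icc (0 : ℝ) (dist x y), (ψ' s : X) = ψ s := by
        intro s hs; simp only [ψ', dif_pos hs]
      have hψ' : IsGeodesic ψ' ⟨x, hx⟩ ⟨y, hy⟩ := by
        refine ⟨Subtype.ext ?_, Subtype.ext ?_, ?_⟩
        · rw [hval 0 ⟨le_rfl, dist_nonneg⟩]; exact hψ.map_zero
        · rw [hd, hval _ ⟨dist_nonneg, le_rfl⟩]; exact hψ.map_dist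
        · intro s hs t ht
          rw [Subtype.dist_eq, hval s hs, hval t ht]; exact hψ.dist_map s hs t ht
      have ht' : t ∈ Icc (0 : ℝ) (dist x y) := Ioo_subset_Icc_self ht
      refine ⟨t, ht, ?_⟩
      have := huniq ψ' hψ' ht'
      simp only [← this, hval t ht']
    · rintro ⟨t, ht, rfl⟩
      exact ⟨_, hφ2, t, ht, rfl⟩
  have hsub : openSeg x y ⊆ skeleton ι := fun z hz =>
    mem_iUnion.2 ⟨x, mem_iUnion₂.2 ⟨y, hy, hz⟩⟩
  rw [lengthMeasure, Measure.restrict_eq_self _ hsub, heq]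
  have hiso : Isometry (fun t : Ioo (0 : ℝ) (dist x y) => (φ t : X)) := by
    refine Isometry.of_dist_eq fun s t => ?_
    rw [hφ2.dist_map s (Ioo_subset_Icc_self s.2) t (Ioo_subset_Icc_self t.2)]
    rfl
  have h1 := hiso.hausdorffMeasure_image (d := 1) (Or.inl zero_le_one) univ
  have h2 := (isometry_subtype_coe (s := Ioo (0 : ℝ) (dist x y))).hausdorffMeasure_image
    (d := 1) (Or.inl zero_le_one) univ
  rw [image_univ, Subtype.range_coe, hausdorffMeasure_real, Real.volume_Ioo, sub_zero] at h2
  rw [h2, ← h1]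
  congr 1
  ext z
  simp

end LocalTree

end

/-! Both inequalities compare `totalVariation` with the double integral `pairEnergy`, taken over
pairs at distance less than r. Uniform volume control makes `ksEnergy m Φ 1 f r` comparable with
that integral divided by Φ(r)².

Energy below variation (`ksEnergy_le_totalVariation`). If f has an absolute gradient h, then |f(y) -
f(x)| is at most the integral of |h| over the segment from x to y. By Tonelli, a point z is charged
by the pairs whose segment contains it. Both endpoints of such a pair lie in B(z, r), so their
product measure is at most (C₁Φ(r))². The resulting bound is uniform in r, and at fixed r the energy
is L¹-continuous, so the bound passes to the relaxation.

Variation below energy (`exists_approximation`). At scale ε = r/6, f is replaced by a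
partition-of-unity average of its means over the balls of an ε-net. Ordinary Lipschitz cutoffs would
not do: the length measure of a ball may be infinite, so a gradient of size 1/ε on the whole ball is
useless. In a tree, however, B(v, ε) can be separated from the complement of B(v, 2ε) by a function
that varies only along the branches reaching radius 2ε. Packing bounds the number of these branches
at radius 3ε/2 by some N. The cutoff therefore has slope at most 2/ε on a finite tree of length at
most 3Nε/2 and is locally constant elsewhere, so its gradient has L¹ norm bounded independently of
ε. Summing over the net bounds the gradient integral by the energy at scale r. The L¹ error is at
most a constant times Φ(r) times the energy, and Φ(r) → 0, so a sequence of scales realizing the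
liminf is admissible in the relaxation.

The tree geometry enters through 0-hyperbolicity (`IsRealTree.hyperbolic`), derived from the axiom
on injective paths. Gradients exist because locally Lipschitz functions are differentiable a.e.
along each segment, and the absolute radial derivatives from different base points agree a.e.
(`ae_abs_radialDeriv_eq`). -/

noncomputable section

namespace LocalTree

/-- The Gromov product `(a | b)_o`. -/
def gromovProd {X : Type*} [MetricSpace X] (o a b : X) : ℝ :=
  (dist o a + dist o b - dist a b) / 2

/-- The metric interval between `x` and `y`. -/
def between {X : Type*} [MetricSpace X] (x y : X) : Set X :=
  {z | dist x z + dist z y = dist x y}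

/-! ### Geodesics and metric intervals -/

section Geodesic

variable {X : Type*} [MetricSpace X]

theorem IsGeodesic.dist_left {φ : ℝ → X} {x y : X} (h : IsGeodesic φ x y) {t : ℝ}
    (ht : t ∈ Icc 0 (dist x y)) : dist x (φ t) = t := by
  have := h.dist_map 0 ⟨le_rfl, dist_nonneg⟩ t ht
  rw [h.map_zero, zero_sub, abs_neg, abs_of_nonneg ht.1] at this
  exact this

theorem IsGeodesic.dist_right {φ : ℝ → X} {x y : X} (h : IsGeodesic φ x y) {t : ℝ}
    (ht : t ∈ Icc 0 (dist x y)) : dist (φ t) y = dist x y - t := by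
  have := h.dist_map t ht (dist x y) ⟨dist_nonneg, le_rfl⟩
  rw [h.map_dist, abs_of_nonpos (by linarith [ht.2])] at this
  linarith

theorem IsGeodesic.mem_between {φ : ℝ → X} {x y : X} (h : IsGeodesic φ x y) {t : ℝ}
    (ht : t ∈ Icc 0 (dist x y)) : φ t ∈ between x y := by
  change dist x (φ t) + dist (φ t) y = dist x y
  rw [h.dist_left ht, h.dist_right ht]; ring

theorem IsGeodesic.continuousOn {φ : ℝ → X} {x y : X} (h : IsGeodesic φ x y) :
    ContinuousOn φ (Icc 0 (dist x y)) := by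
  have : LipschitzOnWith 1 φ (Icc 0 (dist x y)) := by
    refine LipschitzOnWith.of_dist_le_mul fun s hs t ht => ?_
    rw [h.dist_map s hs t ht, Real.dist_eq]; simp
  exact this.continuousOn

theorem IsGeodesic.restrict {φ : ℝ → X} {x y : X} (h : IsGeodesic φ x y) {t : ℝ}
    (ht : t ∈ Icc 0 (dist x y)) : IsGeodesic φ x (φ t) := by
  have hd := h.dist_left ht
  refine ⟨h.map_zero, by rw [hd], fun s hs u hu => ?_⟩
  rw [hd] at hs hu
  exact h.dist_map s ⟨hs.1, hs.2.trans ht.2⟩ u ⟨hu.1, hu.2.trans ht.2⟩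

/-- Every geodesic can be replaced by one which is `1`-Lipschitz on the whole real line. -/
theorem IsGeodesic.exists_lipschitz {φ : ℝ → X} {x y : X} (h : IsGeodesic φ x y) :
    ∃ ψ : ℝ → X, IsGeodesic ψ x y ∧ LipschitzWith 1 ψ ∧
      EqOn ψ φ (Icc 0 (dist x y)) := by
  have h0 : (0 : ℝ) ≤ dist x y := dist_nonneg
  have heq : EqOn (fun t => φ (projIcc 0 (dist x y) h0 t)) φ (Icc 0 (dist x y)) := by
    intro t ht
    simp only [projIcc_of_mem h0 ht]
  refine ⟨_, ⟨?_, ?_, ?_⟩, ?_, heq⟩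
  · exact (heq ⟨le_rfl, h0⟩).trans h.map_zero
  · exact (heq ⟨h0, le_rfl⟩).trans h.map_dist
  · intro s hs t ht
    exact (congrArg₂ dist (heq hs) (heq ht)).trans (h.dist_map s hs t ht)
  · refine LipschitzWith.of_dist_le_mul fun s t => ?_
    rw [h.dist_map _ (projIcc 0 _ h0 s).2 _ (projIcc 0 _ h0 t).2, ← Real.dist_eq, NNReal.coe_one,
      one_mul]
    have := (LipschitzWith.projIcc h0).dist_le_mul s t
    rwa [NNReal.coe_one, one_mul] at this

theorem isClosed_between (x y : X) : IsClosed (between x y) :=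
  isClosed_eq (by fun_prop) (by fun_prop)

theorem openSeg_subset_between (x y : X) : openSeg x y ⊆ between x y := by
  rintro z ⟨φ, hφ, t, ht, rfl⟩
  exact hφ.mem_between (Ioo_subset_Icc_self ht)

theorem openSeg_subset_ball {x y : X} {r : ℝ} (hy : y ∈ ball x r) : openSeg x y ⊆ ball x r := by
  intro z hz
  have h : dist x z + dist z y = dist x y := openSeg_subset_between x y hz
  rw [mem_ball, dist_comm] at hy ⊢
  linarith [dist_nonneg (x := z) (y := y)]

end Geodesic

/-! ### Real trees are 0-hyperbolic -/

section RealTree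

variable {T : Type*} [MetricSpace T]

/-- Two geodesics with the same origin which meet at time `t` agree on `[0, t]`. -/
theorem IsRealTree.eqOn_of_eq (hT : IsRealTree T) {o a b : T} {φ ψ : ℝ → T}
    (hφ : IsGeodesic φ o a) (hψ : IsGeodesic ψ o b) {t : ℝ} (hta : t ∈ Icc 0 (dist o a))
    (htb : t ∈ Icc 0 (dist o b)) (h : φ t = ψ t) {s : ℝ} (hs : s ∈ Icc 0 t) : φ s = ψ s := by
  obtain ⟨χ, -, huniq⟩ := hT.unique_geodesic o (φ t)
  have h1 := huniq φ (hφ.restrict hta)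
  have h2 := huniq ψ (by rw [h]; exact hψ.restrict htb)
  rw [hφ.dist_left hta] at h1 h2
  rw [h1 hs, h2 hs]

/-- Let τ be the last time at which the two geodesics agree. If τ falls short of both lengths,
running back from a to the branch point and then out to b is an injective path. It traces the
geodesic from a to b, so the branch point lies between a and b, and this says that τ is the Gromov
product. -/
theorem IsRealTree.eq_of_le_gromovProd (hT : IsRealTree T) {o a b : T} {φ ψ : ℝ → T}
    (hφ : IsGeodesic φ o a) (hψ : IsGeodesic ψ o b) {t : ℝ} (ht0 : 0 ≤ t)
    (ht : t ≤ gromovProd o a b) : φ t = ψ t := by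
  set A := dist o a with hA
  set B := dist o b with hB
  have hgA : gromovProd o a b ≤ A := by
    have := dist_triangle o a b; simp only [gromovProd]; linarith
  have hgB : gromovProd o a b ≤ B := by
    have := dist_triangle o b a; simp only [gromovProd]; rw [dist_comm a b]; linarith
  let S : Set ℝ := {s | s ∈ Icc 0 (min A B) ∧ φ s = ψ s}
  have hmin0 : (0 : ℝ) ≤ min A B := le_min dist_nonneg dist_nonneg
  have hScl : IsClosed S := by
    have hc1 : ContinuousOn φ (Icc 0 (min A B)) :=
      hφ.continuousOn.mono (Icc_subset_Icc_right (min_le_left _ _))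
    have hc2 : ContinuousOn ψ (Icc 0 (min A B)) :=
      hψ.continuousOn.mono (Icc_subset_Icc_right (min_le_right _ _))
    have : S = Icc 0 (min A B) ∩ (fun s => dist (φ s) (ψ s)) ⁻¹' {0} := by
      ext s; simp [S, dist_eq_zero]
    rw [this]
    exact (continuous_dist.comp_continuousOn (hc1.prodMk hc2)).preimage_isClosed_of_isClosed
      isClosed_Icc isClosed_singleton
  have hS0 : (0 : ℝ) ∈ S := ⟨⟨le_rfl, hmin0⟩, by rw [hφ.map_zero, hψ.map_zero]⟩
  have hSbdd : BddAbove S := ⟨min A B, fun s hs => hs.1.2⟩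
  have hm : sSup S ∈ S := hScl.csSup_mem ⟨0, hS0⟩ hSbdd
  set τ := sSup S with hτ
  have hτA : τ ∈ Icc 0 A := ⟨hm.1.1, hm.1.2.trans (min_le_left _ _)⟩
  have hτB : τ ∈ Icc 0 B := ⟨hm.1.1, hm.1.2.trans (min_le_right _ _)⟩
  suffices hle : gromovProd o a b ≤ τ from
    hT.eqOn_of_eq hφ hψ hτA hτB hm.2 ⟨ht0, ht.trans hle⟩
  rcases eq_or_lt_of_le hτA.2 with hτA' | hτA'
  · rw [hτA']; exact hgA
  rcases eq_or_lt_of_le hτB.2 with hτB' | hτB'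
  · rw [hτB']; exact hgB
  -- the path running from `a` to the branch point along `φ`, and then to `b` along `ψ`
  let L := (A - τ) + (B - τ)
  have hL : 0 < L := by simp only [L]; linarith
  let κ : ℝ → T := fun s => if s * L ≤ A - τ then φ (A - s * L) else ψ (s * L - A + 2 * τ)
  have hκc : ContinuousOn κ (Icc 0 1) := by
    have hcl : ∀ s ∈ closure {s : ℝ | s * L ≤ A - τ}, s * L ≤ A - τ := by
      intro s hs
      rwa [(isClosed_le (by fun_prop) (by fun_prop)).closure_eq] at hs
    have hcl' : ∀ s ∈ closure {s : ℝ | ¬ s * L ≤ A - τ}, A - τ ≤ s * L := by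
      intro s hs
      have : closure {s : ℝ | ¬ s * L ≤ A - τ} ⊆ {s : ℝ | A - τ ≤ s * L} :=
        closure_minimal (fun u hu => (not_le.1 hu).le) (isClosed_le (by fun_prop) (by fun_prop))
      exact this hs
    refine ContinuousOn.if ?_ ?_ ?_
    · rintro s ⟨hs, hs'⟩
      have h1 := hcl s (frontier_subset_closure hs')
      rw [← frontier_compl] at hs'
      have h2 := hcl' s (frontier_subset_closure hs')
      have h3 : s * L = A - τ := le_antisymm h1 h2
      rw [h3, show A - (A - τ) = τ by ring, show A - τ - A + 2 * τ = τ by ring]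
      exact hm.2
    · refine hφ.continuousOn.comp (by fun_prop) ?_
      rintro s ⟨hs, hs'⟩
      have := hcl s hs'
      have := mul_nonneg hs.1 hL.le
      exact ⟨by linarith [hτA.1], by linarith⟩
    · refine hψ.continuousOn.comp (by fun_prop) ?_
      rintro s ⟨hs, hs'⟩
      have := hcl' s hs'
      have := mul_le_mul_of_nonneg_right hs.2 hL.le
      exact ⟨by linarith [hτA.1], by simp only [L] at *; linarith⟩
  -- The two arms cannot cross: a common point has one distance to o, hence is reached at the same
  -- time by φ and ψ, and that time would exceed τ.
  have hmix : ∀ s ∈ Icc (0 : ℝ) 1, ∀ u ∈ Icc (0 : ℝ) 1, s * L ≤ A - τ → ¬ u * L ≤ A - τ →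
      φ (A - s * L) ≠ ψ (u * L - A + 2 * τ) := by
    intro s hs u hu h1 h2 heq
    rw [not_le] at h2
    have hs0 := mul_nonneg hs.1 hL.le
    have hu1 := mul_le_mul_of_nonneg_right hu.2 hL.le
    have m1 : A - s * L ∈ Icc 0 A := ⟨by linarith [hτA.1], by linarith⟩
    have m2 : u * L - A + 2 * τ ∈ Icc 0 B :=
      ⟨by linarith [hτA.1], by simp only [L] at *; linarith⟩
    have d1 := hφ.dist_left m1
    have d2 := hψ.dist_left m2
    rw [heq, d2] at d1
    have : A - s * L ∈ S := ⟨⟨m1.1, le_min m1.2 (d1 ▸ m2.2)⟩, by rw [heq, d1]⟩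
    have := le_csSup hSbdd this
    linarith
  have hκi : InjOn κ (Icc 0 1) := by
    intro s hs u hu h
    have hs0 := mul_nonneg hs.1 hL.le
    have hu0 := mul_nonneg hu.1 hL.le
    have hu1 := mul_le_mul_of_nonneg_right hu.2 hL.le
    have hs1 := mul_le_mul_of_nonneg_right hs.2 hL.le
    have key : s * L = u * L → s = u := fun h => mul_right_cancel₀ hL.ne' h
    simp only [κ] at h
    split_ifs at h with h1 h2 h2
    · have d1 := hφ.dist_left (t := A - s * L) ⟨by linarith [hτA.1], by linarith⟩
      have d2 := hφ.dist_left (t := A - u * L) ⟨by linarith [hτA.1], by linarith⟩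
      rw [h, d2] at d1
      exact key (by linarith)
    · exact absurd h (hmix s hs u hu h1 h2)
    · exact absurd h.symm (hmix u hu s hs h2 h1)
    · rw [not_le] at h1 h2
      have d1 := hψ.dist_left (t := s * L - A + 2 * τ)
        ⟨by linarith [hτA.1], by simp only [L] at *; linarith⟩
      have d2 := hψ.dist_left (t := u * L - A + 2 * τ)
        ⟨by linarith [hτA.1], by simp only [L] at *; linarith⟩
      rw [h, d2] at d1
      exact key (by linarith)
  have hκ0 : κ 0 = a := by
    simp only [κ, zero_mul, sub_zero]
    rw [if_pos (by linarith)]; exact hφ.map_dist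
  have hκ1 : κ 1 = b := by
    simp only [κ, one_mul]
    rw [if_neg (by simp only [L]; linarith),
      show L - A + 2 * τ = B by simp only [L]; ring]
    exact hψ.map_dist
  obtain ⟨χ, hχ, -⟩ := hT.unique_geodesic (κ 0) (κ 1)
  have himg := hT.loop_free κ hκc hκi χ hχ
  have hmem : φ τ ∈ χ '' Icc 0 (dist (κ 0) (κ 1)) := by
    rw [← himg]
    refine ⟨(A - τ) / L, ⟨by have := hτA.2; positivity, ?_⟩, ?_⟩
    · rw [div_le_one hL]; simp only [L]; linarith
    · simp only [κ]
      rw [div_mul_cancel₀ _ hL.ne', if_pos le_rfl]; congr 1; ring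
  obtain ⟨u, hu, hu'⟩ := hmem
  have hb := hχ.mem_between hu
  rw [hu', hκ0, hκ1] at hb
  change dist a (φ τ) + dist (φ τ) b = dist a b at hb
  have e1 := hφ.dist_right hτA
  have e2 := hψ.dist_right hτB
  rw [hm.2] at hb e1
  rw [dist_comm] at e1
  rw [e1, e2] at hb
  simp only [gromovProd]
  linarith

/-- Up to the smaller of the two products the geodesics to a, b and c all coincide. The triangle
inequality through the common point at that time then bounds d(a, c). -/
theorem IsRealTree.hyperbolic (hT : IsRealTree T) (o a b c : T) :
    min (gromovProd o a b) (gromovProd o b c) ≤ gromovProd o a c := by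
  obtain ⟨φ, hφ, -⟩ := hT.unique_geodesic o a
  obtain ⟨ψ, hψ, -⟩ := hT.unique_geodesic o b
  obtain ⟨χ, hχ, -⟩ := hT.unique_geodesic o c
  set t := min (gromovProd o a b) (gromovProd o b c) with ht
  have h0 : 0 ≤ t := by
    refine le_min ?_ ?_
    · have := dist_triangle_left a b o; simp only [gromovProd]; linarith
    · have := dist_triangle_left b c o; simp only [gromovProd]; linarith
  have h1 := hT.eq_of_le_gromovProd hφ hψ h0 (min_le_left _ _)
  have h2 := hT.eq_of_le_gromovProd hψ hχ h0 (min_le_right _ _)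
  have ha : t ≤ dist o a := (min_le_left _ _).trans (by
    have := dist_triangle o a b; simp only [gromovProd]; linarith)
  have hc : t ≤ dist o c := (min_le_right _ _).trans (by
    have := dist_triangle o c b; simp only [gromovProd]; rw [dist_comm b c]; linarith)
  have e1 := hφ.dist_right ⟨h0, ha⟩
  have e2 := hχ.dist_right ⟨h0, hc⟩
  have := dist_triangle_left a c (φ t)
  rw [e1, h1, h2, e2] at this
  simp only [gromovProd]
  linarith

end RealTree

/-! ### Tree-like subsets of a metric space -/

/-- A subset `B` of a metric space which is geodesic and `0`-hyperbolic. -/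
structure IsTreeSet {X : Type*} [MetricSpace X] (B : Set X) : Prop where
  exists_geodesic : ∀ x ∈ B, ∀ y ∈ B, ∃ φ : ℝ → X, IsGeodesic φ x y ∧ LipschitzWith 1 φ ∧
    ∀ t ∈ Icc 0 (dist x y), φ t ∈ B
  hyperbolic : ∀ o ∈ B, ∀ a ∈ B, ∀ b ∈ B, ∀ c ∈ B,
    min (gromovProd o a b) (gromovProd o b c) ≤ gromovProd o a c

section TreeSet

variable {X : Type*} [MetricSpace X] {B : Set X}

theorem isTreeSet_of_isRealTree (hB : IsRealTree B) : IsTreeSet B := by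
  refine ⟨fun x hx y hy => ?_, fun o ho a ha b hb c hc =>
    hB.hyperbolic ⟨o, ho⟩ ⟨a, ha⟩ ⟨b, hb⟩ ⟨c, hc⟩⟩
  obtain ⟨φ, hφ, -⟩ := hB.unique_geodesic ⟨x, hx⟩ ⟨y, hy⟩
  have hg : IsGeodesic (fun t => (φ t : X)) x y :=
    ⟨by simp [hφ.map_zero], congrArg Subtype.val hφ.map_dist,
      fun s hs t ht => hφ.dist_map s hs t ht⟩
  obtain ⟨ψ, hψ, hL, heq⟩ := hg.exists_lipschitz
  exact ⟨ψ, hψ, hL, fun t ht => by rw [heq ht]; exact (φ t).2⟩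

/-- Points between `p` and `q` are determined by their distance to `p`. -/
theorem IsTreeSet.eq_of_between (hB : IsTreeSet B) {p q w w' : X} (hp : p ∈ B) (hq : q ∈ B)
    (hw : w ∈ B) (hw' : w' ∈ B) (h : w ∈ between p q) (h' : w' ∈ between p q)
    (hd : dist p w = dist p w') : w = w' := by
  have key := hB.hyperbolic p hp w hw q hq w' hw'
  change dist p w + dist w q = dist p q at h
  change dist p w' + dist w' q = dist p q at h'
  simp only [gromovProd] at key
  rw [dist_comm q w'] at key
  rcases min_le_iff.1 key with k | k <;>
    exact dist_le_zero.1 (by linarith [dist_nonneg (x := w) (y := w')])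

theorem between_subset_ball {x y : X} {r : ℝ} (hy : y ∈ ball x r) : between x y ⊆ ball x r := by
  intro z hz
  have h : dist x z + dist z y = dist x y := hz
  rw [mem_ball, dist_comm] at hy ⊢
  linarith [dist_nonneg (x := z) (y := y)]

/-- In a tree, the segments issued from the centre of a ball are metric intervals. -/
theorem IsGeodesic.eq_of_between {x y : X} {r : ℝ} (hB : IsTreeSet (ball x r)) (hy : y ∈ ball x r)
    {φ : ℝ → X} (hφ : IsGeodesic φ x y) {z : X} (hz : z ∈ between x y) : φ (dist x z) = z := by
  have hx : x ∈ ball x r := mem_ball_self (dist_nonneg.trans_lt hy)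
  have hz' : dist x z + dist z y = dist x y := hz
  have ht : dist x z ∈ Icc 0 (dist x y) :=
    ⟨dist_nonneg, by linarith [dist_nonneg (x := z) (y := y)]⟩
  have hm := hφ.mem_between ht
  exact hB.eq_of_between hx hy (between_subset_ball hy hm) (between_subset_ball hy hz) hm hz
    (hφ.dist_left ht)

theorem IsGeodesic.openSeg_eq {x y : X} {r : ℝ} (hB : IsTreeSet (ball x r)) (hy : y ∈ ball x r)
    {φ : ℝ → X} (hφ : IsGeodesic φ x y) : openSeg x y = φ '' Ioo 0 (dist x y) := by
  ext z
  constructor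
  · rintro ⟨ψ, hψ, t, ht, rfl⟩
    have h1 := hφ.eq_of_between hB hy (hψ.mem_between (Ioo_subset_Icc_self ht))
    rw [hψ.dist_left (Ioo_subset_Icc_self ht)] at h1
    exact ⟨t, ht, h1⟩
  · rintro ⟨t, ht, rfl⟩
    exact ⟨φ, hφ, t, ht, rfl⟩

/-- Expresses the segment by distances alone, with no choice of geodesic. Measurability of segments
follows, since metric intervals are closed. -/
theorem openSeg_eq_between_diff {x y : X} {r : ℝ} (hB : IsTreeSet (ball x r))
    (hy : y ∈ ball x r) : openSeg x y = between x y \ {x, y} := by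
  have hx : x ∈ ball x r := mem_ball_self (dist_nonneg.trans_lt hy)
  obtain ⟨φ, hφ, -, -⟩ := hB.exists_geodesic x hx y hy
  rw [hφ.openSeg_eq hB hy]
  ext z
  constructor
  · rintro ⟨t, ht, rfl⟩
    have ht' := Ioo_subset_Icc_self ht
    refine ⟨hφ.mem_between ht', ?_⟩
    have h1 := hφ.dist_left ht'
    have h2 := hφ.dist_right ht'
    rintro (h | h)
    · rw [h, dist_self] at h1; exact ht.1.ne h1
    · rw [h, dist_self] at h2; linarith [ht.2]
  · rintro ⟨hz, hne⟩
    simp only [mem_insert_iff, mem_singleton_iff, not_or] at hne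
    have h : dist x z + dist z y = dist x y := hz
    refine ⟨dist x z, ⟨dist_pos.2 (Ne.symm hne.1), ?_⟩, hφ.eq_of_between hB hy hz⟩
    linarith [dist_pos.2 hne.2]

end TreeSet

/-! ### The skeleton and short segments -/

section Skeleton

variable {X : Type*} [MetricSpace X] {ι : X → ℝ}

theorem openSeg_subset_skeleton {x y : X} (hy : y ∈ ball x (ι x)) :
    openSeg x y ⊆ skeleton ι := fun _ hz =>
  mem_iUnion.2 ⟨x, mem_iUnion₂.2 ⟨y, hy, hz⟩⟩

/-- Every point of the skeleton lies on a short open segment with endpoints in a given dense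
set. -/
theorem exists_mem_openSeg (htree : ∀ x, IsTreeSet (ball x (ι x))) {D : Set X} (hD : Dense D)
    {z : X} (hz : z ∈ skeleton ι) {δ : ℝ} (hδ : 0 < δ) (hι : ∀ x ∈ ball z δ, 2 * δ ≤ ι x) :
    ∃ p ∈ D, ∃ q ∈ D, p ∈ ball z δ ∧ q ∈ ball z δ ∧ q ∈ ball p (ι p) ∧ z ∈ openSeg p q := by
  simp only [skeleton, mem_iUnion] at hz
  obtain ⟨x, y, hy, φ, hφ, t, ht, rfl⟩ := hz
  set L := dist x y with hL
  -- With this σ the points `φ (t ± σ)` lie on the geodesic and within δ of z, with room to move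
  -- each of them by σ / 2 into the dense set.
  set σ := min δ (min t (L - t)) / 2 with hσ
  have hmin : 0 < min δ (min t (L - t)) := lt_min hδ (lt_min ht.1 (by linarith [ht.2]))
  have hσ0 : 0 < σ := by positivity
  have h1 : 2 * σ ≤ δ := by
    rw [hσ]; linarith [min_le_left δ (min t (L - t))]
  have h2 : 2 * σ ≤ t := by
    rw [hσ]; linarith [(min_le_right δ (min t (L - t))).trans (min_le_left _ _)]
  have h3 : 2 * σ ≤ L - t := by
    rw [hσ]; linarith [(min_le_right δ (min t (L - t))).trans (min_le_right _ _)]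
  have ht' := Ioo_subset_Icc_self ht
  have hma : t - σ ∈ Icc 0 L := ⟨by linarith, by linarith [ht.2]⟩
  have hmb : t + σ ∈ Icc 0 L := ⟨by linarith [ht.1], by linarith⟩
  have hbi : ∀ s ∈ Icc 0 L, φ s ∈ ball x (ι x) := fun s hs =>
    between_subset_ball hy (hφ.mem_between hs)
  have daz : dist (φ (t - σ)) (φ t) = σ := by
    rw [hφ.dist_map _ hma _ ht', show t - σ - t = -σ by ring, abs_neg, abs_of_pos hσ0]
  have dbz : dist (φ (t + σ)) (φ t) = σ := by
    rw [hφ.dist_map _ hmb _ ht', show t + σ - t = σ by ring, abs_of_pos hσ0]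
  have dab : dist (φ (t - σ)) (φ (t + σ)) = 2 * σ := by
    rw [hφ.dist_map _ hma _ hmb, show t - σ - (t + σ) = -(2 * σ) by ring, abs_neg,
      abs_of_pos (by linarith)]
  obtain ⟨p, hp, hpD⟩ := hD.inter_open_nonempty (ball (φ (t - σ)) (σ / 2) ∩ ball x (ι x))
    (isOpen_ball.inter isOpen_ball) ⟨_, mem_ball_self (by linarith), hbi _ hma⟩
  obtain ⟨q, hq, hqD⟩ := hD.inter_open_nonempty (ball (φ (t + σ)) (σ / 2) ∩ ball x (ι x))
    (isOpen_ball.inter isOpen_ball) ⟨_, mem_ball_self (by linarith), hbi _ hmb⟩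
  set a := φ (t - σ)
  set b := φ (t + σ)
  set z := φ t
  have hpa : dist p a < σ / 2 := hp.1
  have hqb : dist q b < σ / 2 := hq.1
  have hpz := dist_triangle p a z
  have hqz := dist_triangle q b z
  have hpz' := dist_triangle_left a z p
  have hqz' := dist_triangle_left b z q
  have hpδ : p ∈ ball z δ := by rw [mem_ball]; linarith
  have hqδ : q ∈ ball z δ := by rw [mem_ball]; linarith
  have hqp : q ∈ ball p (ι p) := by
    have := hι p hpδ
    have := dist_triangle_right q p z
    rw [mem_ball] at hpδ hqδ ⊢
    linarith
  refine ⟨p, hpD, q, hqD, hpδ, hqδ, hqp, ?_⟩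
  rw [openSeg_eq_between_diff (htree p) hqp]
  have hz : z ∈ ball x (ι x) := hbi t ht'
  -- Seen from z, the product (a | b) is 0, while (a | p) and (q | b) are positive because p and q
  -- are closer to a and b than z is. Two uses of hyperbolicity force (p | q) = 0, so z lies between
  -- p and q.
  have k1 := (htree x).hyperbolic z hz a (hbi _ hma) p hp.2 b (hbi _ hmb)
  have k2 := (htree x).hyperbolic z hz p hp.2 q hq.2 b (hbi _ hmb)
  simp only [gromovProd, dist_comm z] at k1 k2
  rw [daz, dab, dbz] at k1
  rw [dbz] at k2
  rw [dist_comm a p] at k1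
  have k3 : dist p z + dist q z ≤ dist p q := by
    rcases min_le_iff.1 k1 with k | k
    · linarith
    · rcases min_le_iff.1 k2 with k' | k' <;> linarith
  refine ⟨?_, ?_⟩
  · change dist p z + dist z q = dist p q
    rw [dist_comm z q]
    exact le_antisymm k3 (dist_triangle_right p q z)
  · rintro (h | h)
    · rw [h] at daz; rw [← dist_comm p a] at daz; linarith
    · rw [mem_singleton_iff] at h
      rw [h] at dbz; rw [← dist_comm q b] at dbz; linarith

end Skeleton

/-! ### Length measure on a segment as Lebesgue measure -/

section Segment

variable {X : Type*} [MetricSpace X] [MeasurableSpace X] [BorelSpace X] {ι : X → ℝ}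

theorem measurableSet_openSeg {x y : X} {r : ℝ} (hB : IsTreeSet (ball x r))
    (hy : y ∈ ball x r) : MeasurableSet (openSeg x y) := by
  rw [openSeg_eq_between_diff hB hy]
  exact (isClosed_between x y).measurableSet.diff (Finite.measurableSet (by simp))

/-- A unit speed parametrization of `]x, y[` carries Lebesgue measure to the length measure. -/
theorem exists_measurableEmbedding {x y : X} (hB : IsTreeSet (ball x (ι x)))
    (hy : y ∈ ball x (ι x)) {φ : ℝ → X} (hφ : IsGeodesic φ x y) :
    MeasurableEmbedding (fun t : Ioo 0 (dist x y) => φ t) ∧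
      (lengthMeasure ι).restrict (openSeg x y) =
        Measure.map (fun t : Ioo 0 (dist x y) => φ t) (volume.comap Subtype.val) := by
  have hiso : Isometry (fun t : Ioo (0 : ℝ) (dist x y) => φ t) := by
    refine Isometry.of_dist_eq fun s t => ?_
    rw [hφ.dist_map s (Ioo_subset_Icc_self s.2) t (Ioo_subset_Icc_self t.2)]
    rfl
  have hrange : range (fun t : Ioo (0 : ℝ) (dist x y) => φ t) = openSeg x y := by
    rw [hφ.openSeg_eq hB hy, image_eq_range]
  refine ⟨hiso.isEmbedding.measurableEmbedding
    (by rw [hrange]; exact measurableSet_openSeg hB hy), ?_⟩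
  have hval : Isometry (Subtype.val : Ioo (0 : ℝ) (dist x y) → ℝ) := isometry_subtype_coe
  have h1 := hval.map_hausdorffMeasure (d := 1) (Or.inl zero_le_one)
  rw [Subtype.range_coe, hausdorffMeasure_real] at h1
  have h2 : (volume.comap Subtype.val : Measure (Ioo (0 : ℝ) (dist x y))) = Measure.hausdorffMeasure 1 := by
    have hme := MeasurableEmbedding.subtype_coe (measurableSet_Ioo (a := (0 : ℝ)) (b := dist x y))
    rw [← hme.comap_map (Measure.hausdorffMeasure 1), h1]
    ext s hs
    rw [hme.comap_apply, hme.comap_apply, Measure.restrict_apply (hme.measurableSet_image.2 hs),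
      inter_eq_self_of_subset_left (Subtype.coe_image_subset _ _)]
  rw [h2, hiso.map_hausdorffMeasure (Or.inl zero_le_one), hrange, lengthMeasure,
    Measure.restrict_restrict (measurableSet_openSeg hB hy),
    inter_eq_self_of_subset_left (openSeg_subset_skeleton hy)]

theorem map_subtype_Ioo (L : ℝ) :
    Measure.map (Subtype.val : Ioo (0 : ℝ) L → ℝ) (volume.comap Subtype.val) = volume.restrict (Ioo 0 L) :=
  map_comap_subtype_coe measurableSet_Ioo _

theorem integrableOn_openSeg_iff {x y : X} (hB : IsTreeSet (ball x (ι x)))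
    (hy : y ∈ ball x (ι x)) {φ : ℝ → X} (hφ : IsGeodesic φ x y) {g : X → ℝ} :
    IntegrableOn g (openSeg x y) (lengthMeasure ι) ↔
      IntegrableOn (fun t => g (φ t)) (Ioo 0 (dist x y)) := by
  obtain ⟨he, hm⟩ := exists_measurableEmbedding hB hy hφ
  rw [IntegrableOn, hm, he.integrable_map_iff, IntegrableOn, ← map_subtype_Ioo,
    (MeasurableEmbedding.subtype_coe measurableSet_Ioo).integrable_map_iff]
  rfl

theorem setIntegral_openSeg {x y : X} (hB : IsTreeSet (ball x (ι x)))
    (hy : y ∈ ball x (ι x)) {φ : ℝ → X} (hφ : IsGeodesic φ x y) (g : X → ℝ) :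
    ∫ z in openSeg x y, g z ∂(lengthMeasure ι) = ∫ t in Ioo 0 (dist x y), g (φ t) := by
  obtain ⟨he, hm⟩ := exists_measurableEmbedding hB hy hφ
  rw [hm, he.integral_map, ← map_subtype_Ioo,
    (MeasurableEmbedding.subtype_coe measurableSet_Ioo).integral_map]

theorem ae_openSeg_iff {x y : X} (hB : IsTreeSet (ball x (ι x)))
    (hy : y ∈ ball x (ι x)) {φ : ℝ → X} (hφ : IsGeodesic φ x y) {P : X → Prop} :
    (∀ᵐ z ∂(lengthMeasure ι).restrict (openSeg x y), P z) ↔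
      ∀ᵐ t ∂volume.restrict (Ioo 0 (dist x y)), P (φ t) := by
  obtain ⟨he, hm⟩ := exists_measurableEmbedding hB hy hφ
  rw [hm, he.ae_map_iff, ← map_subtype_Ioo,
    (MeasurableEmbedding.subtype_coe measurableSet_Ioo).ae_map_iff]

end Segment

/-! ### Radial derivatives and their dependence on the base point -/

theorem abs_derivWithin_le {F : ℝ → ℝ} {s : Set ℝ} {x K : ℝ} (hK : 0 ≤ K)
    (h : ∀ᶠ t in 𝓝[s] x, |F t - F x| ≤ K * |t - x|) : |derivWithin F s x| ≤ K := by
  -- In the two degenerate cases `derivWithin` takes its default value 0, so no differentiability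
  -- needs to be assumed.
  by_cases hacc : AccPt x (𝓟 s)
  swap
  · rwa [derivWithin_zero_of_not_accPt hacc, abs_zero]
  by_cases hd : DifferentiableWithinAt ℝ F s x
  swap
  · rwa [derivWithin_zero_of_not_differentiableWithinAt hd, abs_zero]
  have ht := hasDerivWithinAt_iff_tendsto_slope.1 hd.hasDerivWithinAt
  have : (𝓝[s \ {x}] x).NeBot := accPt_principal_iff_nhdsWithin.1 hacc
  refine le_of_tendsto ht.abs ?_
  filter_upwards [nhdsWithin_mono x sdiff_subset h, self_mem_nhdsWithin] with t h1 h2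
  have hne : 0 < |t - x| := abs_pos.2 (sub_ne_zero.2 h2.2)
  rw [slope_def_field, abs_div, div_le_iff₀ hne]
  exact h1

section Radial

variable {X : Type*} [MetricSpace X]

/-- A geodesic from `x` to `z`, if there is one. -/
def geodesicPath (x z : X) : ℝ → X :=
  @Classical.epsilon (ℝ → X) ⟨fun _ => x⟩ (fun φ => IsGeodesic φ x z)

theorem isGeodesic_geodesicPath {x z : X} (h : ∃ φ : ℝ → X, IsGeodesic φ x z) :
    IsGeodesic (geodesicPath x z) x z :=
  @Classical.epsilon_spec _ _ h

/-- The derivative at `z` of `f` along the geodesic from `x` to `z`. -/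
def radialDeriv (f : X → ℝ) (x z : X) : ℝ :=
  derivWithin (f ∘ geodesicPath x z) (Icc 0 (dist x z)) (dist x z)

theorem IsTreeSet.geodesicPath {x z : X} {r : ℝ} (hB : IsTreeSet (ball x r))
    (hz : z ∈ ball x r) : IsGeodesic (geodesicPath x z) x z := by
  obtain ⟨φ, hφ, -, -⟩ := hB.exists_geodesic x (mem_ball_self (dist_nonneg.trans_lt hz)) z hz
  exact isGeodesic_geodesicPath ⟨φ, hφ⟩

/-- Inside the interval from x to z a point is determined by its distance to x, so a curve
parametrized by that distance coincides with the chosen geodesic near z. Only the last piece of the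
curve, on [a, d(x, z)], matters for the one-sided derivative. -/
theorem radialDeriv_eq {f : X → ℝ} {x z : X} {r : ℝ} (hB : IsTreeSet (ball x r))
    (hz : z ∈ ball x r) {ψ : ℝ → X} {a c : ℝ} (ha : 0 ≤ a) (had : a < dist x z)
    (hψ : ∀ τ ∈ Icc a (dist x z), dist x (ψ τ) = τ ∧ ψ τ ∈ between x z)
    (hc : HasDerivWithinAt (f ∘ ψ) c (Icc a (dist x z)) (dist x z)) :
    radialDeriv f x z = c := by
  have hg := hB.geodesicPath hz
  have heq : ∀ τ ∈ Icc a (dist x z), geodesicPath x z τ = ψ τ := by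
    intro τ hτ
    have h := hg.eq_of_between hB hz (hψ τ hτ).2
    rwa [(hψ τ hτ).1] at h
  have h1 : HasDerivWithinAt (f ∘ geodesicPath x z) c (Icc a (dist x z)) (dist x z) :=
    hc.congr (fun τ hτ => congrArg f (heq τ hτ)) (congrArg f (heq _ ⟨had.le, le_rfl⟩))
  have h2 : HasDerivWithinAt (f ∘ geodesicPath x z) c (Icc 0 (dist x z)) (dist x z) := by
    refine h1.mono_of_mem_nhdsWithin ?_
    have : Ioi a ∈ 𝓝 (dist x z) := Ioi_mem_nhds had
    filter_upwards [nhdsWithin_le_nhds this, self_mem_nhdsWithin] with τ h1 h2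
    exact ⟨le_of_lt h1, h2.2⟩
  exact h2.derivWithin (uniqueDiffOn_Icc (ha.trans_lt had) _ ⟨dist_nonneg, le_rfl⟩)

theorem abs_radialDeriv_le {f : X → ℝ} {x z : X} {r : ℝ} (hB : IsTreeSet (ball x r))
    (hz : z ∈ ball x r) {K : NNReal} {s : Set X} (hs : s ∈ 𝓝 z) (hf : LipschitzOnWith K f s) :
    |radialDeriv f x z| ≤ K := by
  have hg := hB.geodesicPath hz
  refine abs_derivWithin_le K.2 ?_
  have hd : dist x z ∈ Icc 0 (dist x z) := ⟨dist_nonneg, le_rfl⟩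
  have hcont := hg.continuousOn _ hd
  rw [ContinuousWithinAt, hg.map_dist] at hcont
  filter_upwards [hcont hs, self_mem_nhdsWithin] with t ht ht'
  have h1 := hf.dist_le_mul _ ht _ (mem_of_mem_nhds hs)
  have h2 := hg.dist_map t ht' _ hd
  rw [hg.map_dist] at h2
  rw [h2, Real.dist_eq] at h1
  simpa [hg.map_dist] using h1

theorem radialDeriv_geodesic {f : X → ℝ} {p q : X} {r : ℝ} (hB : IsTreeSet (ball p r))
    (hq : q ∈ ball p r) {φ : ℝ → X} (hφ : IsGeodesic φ p q) {t : ℝ} (ht : t ∈ Ioo 0 (dist p q))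
    (hd : DifferentiableAt ℝ (f ∘ φ) t) : radialDeriv f p (φ t) = deriv (f ∘ φ) t := by
  have ht' := Ioo_subset_Icc_self ht
  have hdt := hφ.dist_left ht'
  refine radialDeriv_eq hB (between_subset_ball hq (hφ.mem_between ht')) (ψ := φ) le_rfl
    (by rw [hdt]; exact ht.1) ?_ (by rw [hdt]; exact hd.hasDerivAt.hasDerivWithinAt)
  intro τ hτ
  have h1 := (hφ.restrict ht').mem_between hτ
  rw [hdt] at hτ
  exact ⟨hφ.dist_left ⟨hτ.1, hτ.2.trans ht'.2⟩, h1⟩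

/-- For all but at most one point of `]p, q[`, the geodesic coming from `x` arrives along
`]p, q[`, from one side or the other. -/
theorem subsingleton_branch {x p q : X} {B : Set X} (hB : IsTreeSet B) (hx : x ∈ B)
    {φ : ℝ → X} (hφ : IsGeodesic φ p q) (hφB : ∀ t ∈ Icc 0 (dist p q), φ t ∈ B) :
    {t ∈ Icc 0 (dist p q) |
      (∀ s ∈ Ico 0 t, dist x (φ t) ≠ dist x (φ s) + (t - s)) ∧
      ∀ s ∈ Ioc t (dist p q), dist x (φ t) ≠ dist x (φ s) + (s - t)}.Subsingleton := by
  have main : ∀ t₁ ∈ Icc 0 (dist p q), ∀ t₂ ∈ Icc 0 (dist p q), t₁ < t₂ →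
      (∀ s ∈ Ioc t₁ (dist p q), dist x (φ t₁) ≠ dist x (φ s) + (s - t₁)) →
      (∀ s ∈ Ico 0 t₂, dist x (φ t₂) ≠ dist x (φ s) + (t₂ - s)) → False := by
    intro t₁ h1 t₂ h2 hlt hb1 hb2
    -- Seen from the midpoint φ(t), the points φ(t₁) and φ(t₂) have Gromov product 0. By
    -- hyperbolicity x has product 0 with one of them, so the path from x to that point passes
    -- through φ(t) and arrives along the segment.
    set t := (t₁ + t₂) / 2 with ht
    have ht1 : t₁ < t := by rw [ht]; linarith
    have ht2 : t < t₂ := by rw [ht]; linarith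
    have hti : t ∈ Icc 0 (dist p q) := ⟨h1.1.trans ht1.le, ht2.le.trans h2.2⟩
    have key := hB.hyperbolic _ (hφB t hti) _ (hφB t₁ h1) x hx _ (hφB t₂ h2)
    have d1 := hφ.dist_map t hti t₁ h1
    have d2 := hφ.dist_map t hti t₂ h2
    have d3 := hφ.dist_map t₁ h1 t₂ h2
    rw [abs_of_pos (by linarith)] at d1
    rw [abs_of_neg (by linarith)] at d2 d3
    have tr1 := dist_triangle x (φ t) (φ t₁)
    have tr2 := dist_triangle x (φ t) (φ t₂)
    have c1 := hb1 t ⟨ht1, hti.2⟩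
    have c2 := hb2 t ⟨hti.1, ht2⟩
    simp only [gromovProd, dist_comm (φ t₁) x, dist_comm (φ t) x] at key
    rw [d1, d2, d3] at key
    rcases min_le_iff.1 key with k | k
    · exact c1 (by linarith)
    · exact c2 (by linarith)
  rintro t₁ ⟨h1, h1a, h1b⟩ t₂ ⟨h2, h2a, h2b⟩
  rcases lt_trichotomy t₁ t₂ with h | h | h
  · exact (main t₁ h1 t₂ h2 h h1b h2a).elim
  · exact h
  · exact (main t₂ h2 t₁ h1 h h2b h1a).elim

/-- Near φ(t), on the side from which x is approached, φ is the geodesic from x up to a shift and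
possibly a reversal of time. The two derivatives therefore differ at most by a sign. -/
theorem abs_radialDeriv_eq_of_branch {f : X → ℝ} {x p q : X} {r : ℝ} (hB : IsTreeSet (ball x r))
    {φ : ℝ → X} (hφ : IsGeodesic φ p q) (hφB : ∀ t ∈ Icc 0 (dist p q), φ t ∈ ball x r)
    {t : ℝ} (ht : t ∈ Icc 0 (dist p q)) (hd : DifferentiableAt ℝ (f ∘ φ) t)
    (h : (∃ s ∈ Ico 0 t, dist x (φ t) = dist x (φ s) + (t - s)) ∨
      ∃ s ∈ Ioc t (dist p q), dist x (φ t) = dist x (φ s) + (s - t)) :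
    |radialDeriv f x (φ t)| = |deriv (f ∘ φ) t| := by
  set D := dist x (φ t) with hD
  rcases h with ⟨s, hs, hDs⟩ | ⟨s, hs, hDs⟩
  · have hs' : s ∈ Icc 0 (dist p q) := ⟨hs.1, hs.2.le.trans ht.2⟩
    have h1 : radialDeriv f x (φ t) = deriv (f ∘ φ) t := by
      refine radialDeriv_eq hB (hφB t ht) (ψ := fun τ => φ (t - (D - τ))) (a := dist x (φ s))
        dist_nonneg (by rw [← hD]; linarith [hs.2]) ?_ ?_
      · intro τ hτ
        rw [← hD] at hτ
        have hu : t - (D - τ) ∈ Icc 0 (dist p q) :=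
          ⟨by linarith [hτ.1, hs.1], by linarith [hτ.2, ht.2]⟩
        have d1 := hφ.dist_map s hs' _ hu
        have d2 := hφ.dist_map _ hu t ht
        rw [abs_of_nonpos (by linarith [hτ.1])] at d1
        rw [abs_of_nonpos (by linarith [hτ.2])] at d2
        have tr1 := dist_triangle x (φ s) (φ (t - (D - τ)))
        have tr2 := dist_triangle x (φ (t - (D - τ))) (φ t)
        have e : dist x (φ (t - (D - τ))) = τ := by linarith
        refine ⟨e, ?_⟩
        change dist x _ + dist _ (φ t) = dist x (φ t)
        rw [e, d2]; linarith
      · have hd' : HasDerivAt (f ∘ φ) (deriv (f ∘ φ) t) (t - (D - dist x (φ t))) := by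
          rw [← hD, sub_self, sub_zero]; exact hd.hasDerivAt
        have hlin : HasDerivAt (fun τ : ℝ => t - (D - τ)) 1 (dist x (φ t)) := by
          simpa using ((hasDerivAt_id (dist x (φ t))).const_sub D).const_sub t
        have := (hd'.comp (dist x (φ t)) hlin).hasDerivWithinAt (s := Icc (dist x (φ s)) D)
        rw [mul_one] at this
        exact this
    rw [h1]
  · have hs' : s ∈ Icc 0 (dist p q) := ⟨ht.1.trans hs.1.le, hs.2⟩
    have h1 : radialDeriv f x (φ t) = -deriv (f ∘ φ) t := by
      refine radialDeriv_eq hB (hφB t ht) (ψ := fun τ => φ (t + (D - τ))) (a := dist x (φ s))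
        dist_nonneg (by rw [← hD]; linarith [hs.1]) ?_ ?_
      · intro τ hτ
        rw [← hD] at hτ
        have hu : t + (D - τ) ∈ Icc 0 (dist p q) :=
          ⟨by linarith [hτ.2, ht.1], by linarith [hτ.1, hs.2]⟩
        have d1 := hφ.dist_map s hs' _ hu
        have d2 := hφ.dist_map _ hu t ht
        rw [abs_of_nonneg (by linarith [hτ.1])] at d1
        rw [abs_of_nonneg (by linarith [hτ.2])] at d2
        have tr1 := dist_triangle x (φ s) (φ (t + (D - τ)))
        have tr2 := dist_triangle x (φ (t + (D - τ))) (φ t)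
        have e : dist x (φ (t + (D - τ))) = τ := by linarith
        refine ⟨e, ?_⟩
        change dist x _ + dist _ (φ t) = dist x (φ t)
        rw [e, d2]; linarith
      · have hd' : HasDerivAt (f ∘ φ) (deriv (f ∘ φ) t) (t + (D - dist x (φ t))) := by
          rw [← hD, sub_self, add_zero]; exact hd.hasDerivAt
        have hlin : HasDerivAt (fun τ : ℝ => t + (D - τ)) (-1) (dist x (φ t)) := by
          simpa using ((hasDerivAt_id (dist x (φ t))).const_sub D).const_add t
        have := (hd'.comp (dist x (φ t)) hlin).hasDerivWithinAt (s := Icc (dist x (φ s)) D)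
        rw [mul_neg, mul_one] at this
        exact this
    rw [h1, abs_neg]

/-- A geodesic of `X` between two points of a tree ball stays inside that ball. -/
theorem IsGeodesic.mem_ball_of_mem {x p q : X} {r r' : ℝ} (hB : IsTreeSet (ball x r))
    (hB' : IsTreeSet (ball p r')) (hp : p ∈ ball x r) (hq : q ∈ ball x r) (hq' : q ∈ ball p r')
    {φ : ℝ → X} (hφ : IsGeodesic φ p q) : ∀ t ∈ Icc 0 (dist p q), φ t ∈ ball x r := by
  intro t ht
  obtain ⟨χ, hχ, -, hχB⟩ := hB.exists_geodesic p hp q hq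
  have h := hφ.eq_of_between hB' hq' (hχ.mem_between ht)
  rw [hχ.dist_left ht] at h
  rw [h]; exact hχB t ht

theorem exists_lipschitzOnWith_comp {f : X → ℝ} (hf : LocallyLipschitz f) {φ : ℝ → X}
    (hφ : LipschitzWith 1 φ) (a b : ℝ) : ∃ K, LipschitzOnWith K (f ∘ φ) (Icc a b) :=
  ((hf.comp hφ.locallyLipschitz).locallyLipschitzOn).exists_lipschitzOnWith_of_compact
    isCompact_Icc

theorem ae_differentiableAt_comp {f : X → ℝ} (hf : LocallyLipschitz f) {φ : ℝ → X}
    (hφ : LipschitzWith 1 φ) (L : ℝ) :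
    ∀ᵐ t ∂volume.restrict (Ioo 0 L), DifferentiableAt ℝ (f ∘ φ) t := by
  obtain ⟨K, hK⟩ := exists_lipschitzOnWith_comp hf hφ 0 L
  have := (hK.mono Ioo_subset_Icc_self).ae_differentiableWithinAt_real measurableSet_Ioo
  filter_upwards [this, ae_restrict_mem measurableSet_Ioo] with t h1 h2
  exact h1.differentiableAt (Ioo_mem_nhds h2.1 h2.2)

/-- The skeleton is covered by countably many open segments with endpoints in a countable dense
set. -/
theorem exists_countable_cover_skeleton [TopologicalSpace.SeparableSpace X] {ι : X → ℝ}
    (htree : ∀ x, IsTreeSet (ball x (ι x))) {ι₀ : ℝ}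
    (hι₀ : 0 < ι₀) (hι : ∀ x, ι₀ ≤ ι x) :
    ∃ D : Set (X × X), D.Countable ∧ (∀ d ∈ D, d.2 ∈ ball d.1 (ι d.1)) ∧
      ∀ U : Set X, IsOpen U → skeleton ι ∩ U ⊆
        ⋃ d ∈ {d ∈ D | d.1 ∈ U ∧ d.2 ∈ U}, openSeg d.1 d.2 := by
  obtain ⟨E, hEc, hEd⟩ := TopologicalSpace.exists_countable_dense X
  refine ⟨{d ∈ E ×ˢ E | d.2 ∈ ball d.1 (ι d.1)}, (hEc.prod hEc).mono (sep_subset _ _),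
    fun d hd => hd.2, fun U hU z hz => ?_⟩
  obtain ⟨δ, hδ, hδU⟩ := Metric.isOpen_iff.1 hU z hz.2
  obtain ⟨p, hp, q, hq, hpz, hqz, hqp, hzpq⟩ := exists_mem_openSeg htree hEd hz.1
    (δ := min δ (ι₀ / 2)) (lt_min hδ (by linarith))
    (fun x _ => by linarith [hι x, min_le_right δ (ι₀ / 2)])
  have hsub : ball z (min δ (ι₀ / 2)) ⊆ U := (ball_subset_ball (min_le_left _ _)).trans hδU
  exact mem_biUnion (x := (p, q)) ⟨⟨⟨hp, hq⟩, hqp⟩, hsub hpz, hsub hqz⟩ hzpq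

end Radial

/-! ### Gradients of locally Lipschitz functions -/

section Gradient

variable {X : Type*} [MetricSpace X] [MeasurableSpace X] [BorelSpace X] {ι : X → ℝ}

/-- Along a geodesic issued from x, f is Lipschitz, hence absolutely continuous, and its a.e.
derivative is the radial derivative. The identity is then the fundamental theorem of calculus. -/
theorem isWeakGradientAt_radialDeriv {f : X → ℝ} (hf : LocallyLipschitz f) {x : X}
    (hB : IsTreeSet (ball x (ι x))) : IsWeakGradientAt ι f x (radialDeriv f x) := by
  intro u hu
  have hx : x ∈ ball x (ι x) := mem_ball_self (dist_nonneg.trans_lt hu)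
  obtain ⟨φ, hφ, hφL, -⟩ := hB.exists_geodesic x hx u hu
  rw [integrableOn_openSeg_iff hB hu hφ, setIntegral_openSeg hB hu hφ]
  obtain ⟨K, hK⟩ := exists_lipschitzOnWith_comp hf hφL 0 (dist x u)
  have hac : AbsolutelyContinuousOnInterval (f ∘ φ) 0 (dist x u) := by
    refine LipschitzOnWith.absolutelyContinuousOnInterval (K := K) ?_
    rwa [uIcc_of_le dist_nonneg]
  have hae : (fun t => radialDeriv f x (φ t)) =ᵐ[volume.restrict (Ioo 0 (dist x u))]
      deriv (f ∘ φ) := by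
    filter_upwards [ae_differentiableAt_comp hf hφL (dist x u),
      ae_restrict_mem measurableSet_Ioo] with t h1 h2
    exact radialDeriv_geodesic hB hu hφ h2 h1
  constructor
  · have h1 := hac.intervalIntegrable_deriv
    rw [intervalIntegrable_iff_integrableOn_Ioo_of_le dist_nonneg] at h1
    exact h1.congr hae.symm
  · rw [integral_congr_ae hae, ← integral_Ioc_eq_integral_Ioo,
      ← intervalIntegral.integral_of_le dist_nonneg, hac.integral_deriv_eq_sub]
    simp [hφ.map_zero, hφ.map_dist]

/-- Both sides equal |(f ∘ φ)'| wherever f ∘ φ is differentiable, except possibly at the single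
point where the geodesic from x joins the segment. -/
theorem ae_abs_radialDeriv_eq_openSeg {f : X → ℝ} (hf : LocallyLipschitz f)
    (htree : ∀ x, IsTreeSet (ball x (ι x))) {x p q : X} (hp : p ∈ ball x (ι x))
    (hq : q ∈ ball x (ι x)) (hqp : q ∈ ball p (ι p)) :
    ∀ᵐ z ∂(lengthMeasure ι).restrict (openSeg p q),
      |radialDeriv f x z| = |radialDeriv f p z| := by
  have hp' : p ∈ ball p (ι p) := mem_ball_self (dist_nonneg.trans_lt hqp)
  obtain ⟨φ, hφ, hφL, -⟩ := (htree p).exists_geodesic p hp' q hqp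
  have hφB := hφ.mem_ball_of_mem (htree x) (htree p) hp hq hqp
  have hx : x ∈ ball x (ι x) := mem_ball_self (dist_nonneg.trans_lt hp)
  rw [ae_openSeg_iff (htree p) hqp hφ]
  have hsub := subsingleton_branch (htree x) hx hφ hφB
  have hnull := hsub.measure_zero (volume.restrict (Ioo 0 (dist p q)))
  filter_upwards [ae_differentiableAt_comp hf hφL (dist p q),
    ae_restrict_mem measurableSet_Ioo, compl_mem_ae_iff.2 hnull] with t h1 h2 h3
  have h2' := Ioo_subset_Icc_self h2
  rw [radialDeriv_geodesic (htree p) hqp hφ h2 h1]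
  refine abs_radialDeriv_eq_of_branch (htree x) hφ hφB h2' h1 ?_
  by_contra hcon
  push Not at hcon
  exact h3 ⟨h2', hcon.1, hcon.2⟩

variable [TopologicalSpace.SeparableSpace X]

theorem measurableSet_skeleton (htree : ∀ x, IsTreeSet (ball x (ι x))) {ι₀ : ℝ}
    (hι₀ : 0 < ι₀) (hι : ∀ x, ι₀ ≤ ι x) : MeasurableSet (skeleton ι) := by
  obtain ⟨D, hD, hDι, hcov⟩ := exists_countable_cover_skeleton htree hι₀ hι
  have : skeleton ι = ⋃ d ∈ D, openSeg d.1 d.2 := by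
    refine Subset.antisymm ?_ (iUnion₂_subset fun d hd => openSeg_subset_skeleton (hDι d hd))
    intro z hz
    have := hcov univ isOpen_univ ⟨hz, mem_univ z⟩
    simpa using this
  rw [this]
  exact MeasurableSet.biUnion hD fun d hd => measurableSet_openSeg (htree _) (hDι d hd)

theorem ae_abs_radialDeriv_eq {f : X → ℝ} (hf : LocallyLipschitz f)
    (htree : ∀ x, IsTreeSet (ball x (ι x))) {ι₀ : ℝ} (hι₀ : 0 < ι₀) (hι : ∀ x, ι₀ ≤ ι x)
    (x y : X) : ∀ᵐ z ∂lengthMeasure ι, z ∈ ball x (ι x) → z ∈ ball y (ι y) →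
      |radialDeriv f x z| = |radialDeriv f y z| := by
  obtain ⟨D, hD, hDι, hcov⟩ := exists_countable_cover_skeleton htree hι₀ hι
  -- The part of the skeleton in both balls is covered by segments with both endpoints in the
  -- overlap. On each of them the derivatives from x and from y are both compared with the one from
  -- the endpoint `d.1`.
  have hU := hcov _ ((isOpen_ball (x := x) (ε := ι x)).inter (isOpen_ball (x := y) (ε := ι y)))
  have hseg : ∀ d ∈ D, ∀ᵐ z ∂lengthMeasure ι, z ∈ openSeg d.1 d.2 →
      d.1 ∈ ball x (ι x) ∩ ball y (ι y) → d.2 ∈ ball x (ι x) ∩ ball y (ι y) →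
      |radialDeriv f x z| = |radialDeriv f y z| := by
    intro d hd
    by_cases h : d.1 ∈ ball x (ι x) ∩ ball y (ι y) ∧ d.2 ∈ ball x (ι x) ∩ ball y (ι y)
    swap
    · exact Eventually.of_forall fun z _ h1 h2 => (h ⟨h1, h2⟩).elim
    have hms := measurableSet_openSeg (htree _) (hDι d hd)
    have h1 := (ae_restrict_iff' hms).1
      (ae_abs_radialDeriv_eq_openSeg hf htree h.1.1 h.2.1 (hDι d hd))
    have h2 := (ae_restrict_iff' hms).1
      (ae_abs_radialDeriv_eq_openSeg hf htree h.1.2 h.2.2 (hDι d hd))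
    filter_upwards [h1, h2] with z e1 e2 hz _ _
    rw [e1 hz, e2 hz]
  have hS : ∀ᵐ z ∂lengthMeasure ι, z ∈ skeleton ι :=
    ae_restrict_mem (measurableSet_skeleton htree hι₀ hι)
  filter_upwards [hS, (ae_ball_iff hD).2 hseg] with z hz hall hzx hzy
  obtain ⟨d, hd, hzd⟩ := mem_iUnion₂.1 (hU ⟨hz, hzx, hzy⟩)
  exact hall d hd.1 hzd hd.2.1 hd.2.2

/-- A locally Lipschitz function is absolutely continuous, and its gradient is controlled by its
pointwise Lipschitz constants. -/
theorem exists_isAbsGradient {f : X → ℝ} (hf : LocallyLipschitz f)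
    (htree : ∀ x, IsTreeSet (ball x (ι x))) {ι₀ : ℝ} (hι₀ : 0 < ι₀) (hι : ∀ x, ι₀ ≤ ι x) :
    IsAC ι f ∧ ∃ h : X → ℝ, IsAbsGradient ι f h ∧ ∀ (z : X) (K : NNReal) (s : Set X),
      s ∈ 𝓝 z → LipschitzOnWith K f s → |h z| ≤ K := by
  refine ⟨⟨hf.continuous, fun x => ⟨_, isWeakGradientAt_radialDeriv hf (htree x)⟩⟩, ?_⟩
  obtain ⟨E, hEc, hEd⟩ := TopologicalSpace.exists_countable_dense X
  -- The base point assigned to z is taken from a countable set, so that the a.e. identities for all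
  -- possible base points hold simultaneously.
  have hex : ∀ z : X, ∃ c ∈ E, z ∈ ball c (ι c) := by
    intro z
    obtain ⟨c, hc, hcz⟩ := Metric.dense_iff.1 hEd z ι₀ hι₀
    refine ⟨c, hcz, ?_⟩
    rw [mem_ball, dist_comm] at hc
    exact hc.trans_le (hι c)
  choose c hcE hc using hex
  have hae : ∀ x, ∀ᵐ z ∂lengthMeasure ι, z ∈ ball x (ι x) →
      |radialDeriv f (c z) z| = |radialDeriv f x z| := by
    intro x
    have h := (ae_ball_iff hEc).2 fun e (_ : e ∈ E) => ae_abs_radialDeriv_eq hf htree hι₀ hι e x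
    filter_upwards [h] with z hz hzx
    exact hz (c z) (hcE z) (hc z) hzx
  refine ⟨fun z => |radialDeriv f (c z) z|, ⟨?_, fun x => ⟨_,
    isWeakGradientAt_radialDeriv hf (htree x), (ae_restrict_iff' measurableSet_ball).2 (hae x)⟩⟩,
    fun z K s hs hK => ?_⟩
  -- The choice z ↦ c(z) need not be measurable. On each of countably many segments covering the
  -- skeleton, the function agrees a.e. with one radial derivative, which is measurable there.
  · obtain ⟨D, hD, hDι, hcov⟩ := exists_countable_cover_skeleton htree hι₀ hι
    have hD' := hD.to_subtype
    have hsub : skeleton ι ⊆ ⋃ d : D, openSeg d.1.1 d.1.2 := by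
      intro z hz
      have := hcov univ isOpen_univ ⟨hz, mem_univ z⟩
      simpa using this
    have hle : lengthMeasure ι ≤ (lengthMeasure ι).restrict (⋃ d : D, openSeg d.1.1 d.1.2) := by
      rw [Measure.restrict_eq_self_of_ae_mem]
      filter_upwards [ae_restrict_mem (measurableSet_skeleton htree hι₀ hι)] with z hz
      exact hsub hz
    refine AEStronglyMeasurable.mono_measure ?_ hle
    refine AEStronglyMeasurable.iUnion fun d => ?_
    have hd := hDι d.1 d.2
    have hms := measurableSet_openSeg (htree _) hd
    have h1 := (isWeakGradientAt_radialDeriv hf (htree d.1.1) _ hd).1.aestronglyMeasurable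
    refine h1.norm.congr ?_
    refine (ae_restrict_iff' hms).2 ?_
    filter_upwards [hae d.1.1] with z hz hzd
    exact (hz (openSeg_subset_ball hd hzd)).symm
  · rw [abs_abs]
    exact abs_radialDeriv_le (htree _) (hc z) hs hK

end Gradient

/-! ### The double integral over close pairs -/

/-- The double integral `∬_{d(x, y) < r} |f(y) - f(x)| dm(y) dm(x)`. -/
def pairEnergy {X : Type*} [MetricSpace X] [MeasurableSpace X] (m : Measure X) (f : X → ℝ)
    (r : ℝ) : ℝ≥0∞ :=
  ∫⁻ x, ∫⁻ y in ball x r, ‖f y - f x‖ₑ ∂m ∂m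

section PairEnergy

variable {X : Type*} [MetricSpace X] [MeasurableSpace X]

theorem pairEnergy_congr {m : Measure X} {f g : X → ℝ} (h : f =ᵐ[m] g) (r : ℝ) :
    pairEnergy m f r = pairEnergy m g r := by
  refine lintegral_congr_ae ?_
  filter_upwards [h] with x hx
  refine lintegral_congr_ae ?_
  filter_upwards [ae_restrict_of_ae h] with y hy
  rw [hx, hy]

theorem ksEnergy_one (m : Measure X) (Φ : ℝ → ℝ) (f : X → ℝ) (r : ℝ) :
    ksEnergy m Φ 1 f r = (ENNReal.ofReal (Φ r))⁻¹ *
      ∫⁻ x, (m (ball x r))⁻¹ * ∫⁻ y in ball x r, ‖f y - f x‖ₑ ∂m ∂m := by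
  simp [ksEnergy, scalePsi]

theorem ksEnergy_one_le {m : Measure X} {Φ : ℝ → ℝ} (f : X → ℝ) {r : ℝ} {a : ℝ≥0∞} (ha : a ≠ 0)
    (h : ∀ x, a ≤ m (ball x r)) :
    ksEnergy m Φ 1 f r ≤ (ENNReal.ofReal (Φ r))⁻¹ * (a⁻¹ * pairEnergy m f r) := by
  rw [ksEnergy_one, pairEnergy, ← lintegral_const_mul' _ _ (ENNReal.inv_ne_top.2 ha)]
  gcongr with x
  exact h x

theorem le_ksEnergy_one {m : Measure X} {Φ : ℝ → ℝ} (f : X → ℝ) {r : ℝ} {a : ℝ≥0∞} (ha : a ≠ 0)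
    (h : ∀ x, m (ball x r) ≤ a) :
    (ENNReal.ofReal (Φ r))⁻¹ * (a⁻¹ * pairEnergy m f r) ≤ ksEnergy m Φ 1 f r := by
  rw [ksEnergy_one, pairEnergy, ← lintegral_const_mul' _ _ (ENNReal.inv_ne_top.2 ha)]
  gcongr with x
  exact h x

variable [BorelSpace X] [SecondCountableTopology X] {m : Measure X} [SFinite m]

theorem measurableSet_dist_lt (r : ℝ) : MeasurableSet {p : X × X | dist p.2 p.1 < r} :=
  (isOpen_lt (by fun_prop) (by fun_prop)).measurableSet

theorem lintegral_ball_swap {ψ : X → ℝ≥0∞} (hψ : Measurable ψ) (r : ℝ) :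
    ∫⁻ x, ∫⁻ y in ball x r, ψ y ∂m ∂m = ∫⁻ y, ψ y * m (ball y r) ∂m := by
  have hmeas : Measurable (Function.uncurry fun x y => (ball x r).indicator ψ y) := by
    have : (Function.uncurry fun x y => (ball x r).indicator ψ y) =
        {p : X × X | dist p.2 p.1 < r}.indicator (fun p => ψ p.2) := by
      ext ⟨x, y⟩; simp [indicator, mem_ball]
    rw [this]
    exact (hψ.comp measurable_snd).indicator (measurableSet_dist_lt r)
  simp_rw [← lintegral_indicator measurableSet_ball]
  rw [lintegral_lintegral_swap hmeas.aemeasurable]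
  refine lintegral_congr fun y => ?_
  have : (fun x => (ball x r).indicator ψ y) = (ball y r).indicator fun _ => ψ y := by
    ext x; simp [indicator, mem_ball, dist_comm]
  rw [this, lintegral_indicator measurableSet_ball, setLIntegral_const]

theorem measurable_measure_ball (r : ℝ) : Measurable fun x : X => m (ball x r) :=
  measurable_measure_prodMk_left (measurableSet_dist_lt r)

/-- The error f - g is integrated once at x and once at y. Each contributes at most M times the L¹
distance, the second after Tonelli and the symmetry of the relation d(x, y) < r. -/
theorem pairEnergy_le_add {f g : X → ℝ} (hf : Measurable f) (hg : Measurable g) {r : ℝ}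
    {M : ℝ≥0∞} (hM : ∀ x, m (ball x r) ≤ M) :
    pairEnergy m f r ≤ pairEnergy m g r + 2 * M * ∫⁻ x, ‖f x - g x‖ₑ ∂m := by
  have hu : Measurable fun x => ‖f x - g x‖ₑ := (hf.sub hg).enorm
  have h1 : ∫⁻ x, ‖f x - g x‖ₑ * m (ball x r) ∂m ≤ M * ∫⁻ x, ‖f x - g x‖ₑ ∂m := by
    rw [mul_comm M, ← lintegral_mul_const _ hu]
    gcongr with x
    exact hM x
  calc pairEnergy m f r
      ≤ ∫⁻ x, ∫⁻ y in ball x r, (‖g y - g x‖ₑ + (‖f x - g x‖ₑ + ‖f y - g y‖ₑ)) ∂m ∂m := by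
        refine lintegral_mono fun x => lintegral_mono fun y => ?_
        have : f y - f x = (g y - g x) + (-(f x - g x) + (f y - g y)) := by ring
        calc ‖f y - f x‖ₑ = ‖(g y - g x) + (-(f x - g x) + (f y - g y))‖ₑ := by rw [← this]
          _ ≤ ‖g y - g x‖ₑ + ‖-(f x - g x) + (f y - g y)‖ₑ := enorm_add_le _ _
          _ ≤ _ := by
            gcongr
            exact (enorm_add_le _ _).trans_eq (by rw [enorm_neg])
    _ = ∫⁻ x, (∫⁻ y in ball x r, ‖g y - g x‖ₑ ∂m +
          (‖f x - g x‖ₑ * m (ball x r) + ∫⁻ y in ball x r, ‖f y - g y‖ₑ ∂m)) ∂m := by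
        refine lintegral_congr fun x => ?_
        rw [lintegral_add_left (hg.sub_const _).enorm, lintegral_add_left measurable_const,
          setLIntegral_const]
    _ ≤ pairEnergy m g r + (∫⁻ x, ‖f x - g x‖ₑ * m (ball x r) ∂m +
          ∫⁻ x, ∫⁻ y in ball x r, ‖f y - g y‖ₑ ∂m ∂m) := by
        have hmeas : Measurable fun x => ∫⁻ y in ball x r, ‖g y - g x‖ₑ ∂m := by
          have : Measurable ({p : X × X | dist p.2 p.1 < r}.indicator
              fun p => ‖g p.2 - g p.1‖ₑ) :=
            ((hg.comp measurable_snd).sub (hg.comp measurable_fst)).enorm.indicator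
              (measurableSet_dist_lt r)
          have h2 := this.lintegral_prod_right' (ν := m)
          have h3 : (fun x => ∫⁻ y in ball x r, ‖g y - g x‖ₑ ∂m) = fun x =>
              ∫⁻ y, {p : X × X | dist p.2 p.1 < r}.indicator (fun p => ‖g p.2 - g p.1‖ₑ)
                (x, y) ∂m := by
            ext x
            rw [← lintegral_indicator measurableSet_ball]
            rfl
          rw [h3]
          exact h2
        have hmeas' : Measurable fun x => ‖f x - g x‖ₑ * m (ball x r) :=
          hu.mul (measurable_measure_ball r)
        rw [lintegral_add_left hmeas, lintegral_add_left hmeas']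
        rfl
    _ ≤ pairEnergy m g r + 2 * M * ∫⁻ x, ‖f x - g x‖ₑ ∂m := by
        rw [lintegral_ball_swap hu, two_mul, add_mul]
        gcongr

/-- The increment |f(y) - f(x)| is at most the gradient mass between x and y. After Tonelli, a point
z between x and y with d(x, y) < r has both x and y in B(z, r), whence the factor M * M. -/
theorem pairEnergy_le_of_isAbsGradient {ι : X → ℝ} {f h : X → ℝ} (hh : IsAbsGradient ι f h)
    {r : ℝ} (hr : ∀ x, r ≤ ι x) {M : ℝ≥0∞} (hM0 : M ≠ 0) (hM : ∀ x, m (ball x r) ≤ M) :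
    pairEnergy m f r ≤ M * M * ∫⁻ z, ‖h z‖ₑ ∂lengthMeasure ι := by
  by_cases htop : ∫⁻ z, ‖h z‖ₑ ∂lengthMeasure ι = ∞
  · rw [htop, ENNReal.mul_top (mul_ne_zero hM0 hM0)]; exact le_top
  set w : X → ℝ≥0∞ := fun z => ‖hh.1.mk h z‖ₑ with hw
  have hwm : Measurable w := hh.1.stronglyMeasurable_mk.measurable.enorm
  have hwae : (fun z => ‖h z‖ₑ) =ᵐ[lengthMeasure ι] w := hh.1.ae_eq_mk.fun_comp enorm
  -- The gradient measure is finite in the remaining case, so Tonelli applies without any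
  -- σ-finiteness of the length measure.
  set μ := (lengthMeasure ι).withDensity w with hμ
  have hμuniv : μ univ = ∫⁻ z, ‖h z‖ₑ ∂lengthMeasure ι := by
    rw [hμ, withDensity_apply _ MeasurableSet.univ, Measure.restrict_univ,
      lintegral_congr_ae hwae]
  have hfin : IsFiniteMeasure μ := ⟨by rw [hμuniv]; exact lt_top_iff_ne_top.2 htop⟩
  have hpt : ∀ x, ∀ y ∈ ball x r, ‖f y - f x‖ₑ ≤ μ (between x y) := by
    intro x y hy
    have hy' : y ∈ ball x (ι x) := ball_subset_ball (hr x) hy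
    obtain ⟨g, hg, hgae⟩ := hh.2 x
    rw [(hg y hy').2]
    have hle : (lengthMeasure ι).restrict (openSeg x y) ≤
        (lengthMeasure ι).restrict (ball x (ι x)) :=
      Measure.restrict_mono (openSeg_subset_ball hy') le_rfl
    calc ‖∫ z in openSeg x y, g z ∂lengthMeasure ι‖ₑ
        ≤ ∫⁻ z in openSeg x y, ‖g z‖ₑ ∂lengthMeasure ι := enorm_integral_le_lintegral_enorm _
      _ = ∫⁻ z in openSeg x y, w z ∂lengthMeasure ι := by
          refine lintegral_congr_ae ?_
          filter_upwards [Measure.absolutelyContinuous_of_le hle |>.ae_le hgae,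
            ae_restrict_of_ae hwae] with z h1 h2
          rw [← h2, h1, Real.enorm_abs]
      _ ≤ ∫⁻ z in between x y, w z ∂lengthMeasure ι :=
          lintegral_mono_set (openSeg_subset_between x y)
      _ = μ (between x y) := by
          rw [hμ, withDensity_apply _ (isClosed_between x y).measurableSet]
  -- Segments are enlarged to metric intervals, so that the incidence set is cut out by an open and
  -- a closed condition on distances and is visibly measurable.
  let G : Set ((X × X) × X) := {p | dist p.1.2 p.1.1 < r ∧
    dist p.1.1 p.2 + dist p.2 p.1.2 = dist p.1.1 p.1.2}
  have hG : MeasurableSet G := by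
    refine MeasurableSet.inter (IsOpen.measurableSet ?_) (IsClosed.measurableSet ?_)
    · exact isOpen_lt (f := fun p : (X × X) × X => dist p.1.2 p.1.1) (g := fun _ => r)
        (by fun_prop) (by fun_prop)
    · exact isClosed_eq
        (f := fun p : (X × X) × X => dist p.1.1 p.2 + dist p.2 p.1.2)
        (g := fun p => dist p.1.1 p.1.2) (by fun_prop) (by fun_prop)
  calc pairEnergy m f r
      ≤ ∫⁻ x, ∫⁻ y, μ (Prod.mk (x, y) ⁻¹' G) ∂m ∂m := by
        refine lintegral_mono fun x => ?_
        simp only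
        rw [← lintegral_indicator measurableSet_ball]
        refine lintegral_mono fun y => ?_
        by_cases hy : y ∈ ball x r
        · rw [indicator_of_mem hy]
          refine (hpt x y hy).trans (measure_mono fun z hz => ⟨hy, hz⟩)
        · rw [indicator_of_notMem hy]; exact zero_le
    _ = ∫⁻ p, μ (Prod.mk p ⁻¹' G) ∂m.prod m := by
        rw [lintegral_prod _ (measurable_measure_prodMk_left hG).aemeasurable]
    _ = ∫⁻ z, (m.prod m) ((fun p => (p, z)) ⁻¹' G) ∂μ := by
        rw [← Measure.prod_apply hG, Measure.prod_apply_symm hG]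
    _ ≤ ∫⁻ _, M * M ∂μ := by
        refine lintegral_mono fun z => ?_
        have hsub : (fun p : X × X => (p, z)) ⁻¹' G ⊆ ball z r ×ˢ ball z r := by
          rintro ⟨x, y⟩ ⟨h1, h2⟩
          simp only [dist_comm y x] at h1 h2
          constructor
          · change dist x z < r
            linarith [dist_nonneg (x := z) (y := y)]
          · change dist y z < r
            rw [dist_comm]
            linarith [dist_nonneg (x := x) (y := z)]
        refine (measure_mono hsub).trans ?_
        rw [Measure.prod_prod]
        gcongr <;> exact hM z
    _ = M * M * ∫⁻ z, ‖h z‖ₑ ∂lengthMeasure ι := by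
        rw [lintegral_const, hμuniv]

end PairEnergy

/-! ### Total variation bounds the Korevaar-Schoen energies -/

section LowerBound

variable {X : Type*} [MetricSpace X] [MeasurableSpace X] [BorelSpace X]
  [SecondCountableTopology X] {m : Measure X} [SFinite m] {ι : X → ℝ}

/-- The Korevaar-Schoen energies are controlled by the total variation, at all small scales. -/
theorem ksEnergy_le_totalVariation {Φ : ℝ → ℝ} {r c₁ C₁ : ℝ} (hc₁ : 0 < c₁) (hC₁ : 0 < C₁)
    (hΦr : 0 < Φ r) (hr : ∀ x, r ≤ ι x)
    (hvol : ∀ x, ENNReal.ofReal (c₁ * Φ r) ≤ m (ball x r) ∧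
      m (ball x r) ≤ ENNReal.ofReal (C₁ * Φ r)) (f : Lp ℝ 1 m) :
    ksEnergy m Φ 1 f r ≤ ENNReal.ofReal (C₁ ^ 2 / c₁) * totalVariation m ι f := by
  set κ := ENNReal.ofReal (C₁ ^ 2 / c₁) with hκ
  have hκ0 : κ ≠ 0 := by rw [hκ, Ne, ENNReal.ofReal_eq_zero, not_le]; positivity
  have ha0 : ENNReal.ofReal (c₁ * Φ r) ≠ 0 := by
    rw [Ne, ENNReal.ofReal_eq_zero, not_le]; positivity
  have hM0 : ENNReal.ofReal (C₁ * Φ r) ≠ 0 := by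
    rw [Ne, ENNReal.ofReal_eq_zero, not_le]; positivity
  set A := (ENNReal.ofReal (Φ r))⁻¹ with hA
  set a := (ENNReal.ofReal (c₁ * Φ r))⁻¹ with ha
  set M := ENNReal.ofReal (C₁ * Φ r) with hM
  -- Two powers of Φ(r) from Tonelli cancel the normalizations by Φ(r) and by the ball volume. The
  -- constant left is independent of r.
  have hconst : A * (a * (M * M)) = κ := by
    rw [hA, ha, hM, hκ, ← ENNReal.ofReal_inv_of_pos hΦr, ← ENNReal.ofReal_inv_of_pos (by positivity),
      ← ENNReal.ofReal_mul (by positivity), ← ENNReal.ofReal_mul (by positivity),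
      ← ENNReal.ofReal_mul (by positivity)]
    congr 1
    field_simp
  have hsob : ∀ F : Lp ℝ 1 m, A * (a * pairEnergy m F r) / κ ≤ energyOne m ι F := by
    intro F
    refine le_iInf₂ fun F' hF' => le_iInf₂ fun h hh => ?_
    rw [ENNReal.div_le_iff' hκ0 ENNReal.ofReal_ne_top, ← pairEnergy_congr hF'.1]
    calc A * (a * pairEnergy m F' r)
      _ ≤ A * (a * (M * M * ∫⁻ z, ‖h z‖ₑ ∂lengthMeasure ι)) := by
          gcongr
          exact pairEnergy_le_of_isAbsGradient hh hr hM0 fun x => (hvol x).2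
      _ = κ * ∫⁻ z, ‖h z‖ₑ ∂lengthMeasure ι := by rw [← hconst]; ring
  set K := A * (a * (2 * M)) / κ with hK
  have hK_top : K ≠ ∞ := by
    refine ENNReal.div_ne_top (ENNReal.mul_ne_top ?_ (ENNReal.mul_ne_top ?_ ?_)) hκ0
    · exact ENNReal.inv_ne_top.2 (by rwa [Ne, ENNReal.ofReal_eq_zero, not_le])
    · exact ENNReal.inv_ne_top.2 ha0
    · exact ENNReal.mul_ne_top (by simp) ENNReal.ofReal_ne_top
  -- For fixed r the factor K of the L¹ error is finite, so the error disappears along any sequence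
  -- F n → f.
  have hcmp : ∀ F : Lp ℝ 1 m,
      ksEnergy m Φ 1 f r / κ ≤ energyOne m ι F + K * edist F f := by
    intro F
    have h1 : ksEnergy m Φ 1 f r ≤
        A * (a * pairEnergy m F r) + A * (a * (2 * M)) * edist F f := by
      calc ksEnergy m Φ 1 f r ≤ A * (a * pairEnergy m f r) :=
            ksEnergy_one_le _ ha0 fun x => (hvol x).1
        _ ≤ A * (a * (pairEnergy m F r + 2 * M * edist F f)) := by
            gcongr
            rw [edist_comm, L1.edist_def]
            simp_rw [edist_eq_enorm_sub]
            exact pairEnergy_le_add (Lp.stronglyMeasurable f).measurable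
              (Lp.stronglyMeasurable F).measurable fun x => (hvol x).2
        _ = _ := by ring
    calc ksEnergy m Φ 1 f r / κ
        ≤ (A * (a * pairEnergy m F r) + A * (a * (2 * M)) * edist F f) / κ := by gcongr
      _ = A * (a * pairEnergy m F r) / κ + K * edist F f := by
          rw [ENNReal.add_div, hK]; simp only [div_eq_mul_inv]; ring
      _ ≤ _ := by gcongr; exact hsob F
  rw [← ENNReal.div_le_iff' hκ0 ENNReal.ofReal_ne_top]
  refine le_iInf₂ fun F hF => ?_
  have hlim : Tendsto (fun n => K * edist (F n) f) atTop (𝓝 0) := by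
    have := ENNReal.Tendsto.const_mul (tendsto_iff_edist_tendsto_0.1 hF.2) (Or.inr hK_top)
    rwa [mul_zero] at this
  rw [← ENNReal.liminf_add_of_right_tendsto_zero hlim]
  exact le_liminf_of_le (by isBoundedDefault) (Eventually.of_forall fun n => hcmp (F n))

end LowerBound

theorem finite_and_ncard_le {X : Type*} {A : Set X} {N : ℕ}
    (h : ∀ s : Finset X, (s : Set X) ⊆ A → s.card ≤ N) : A.Finite ∧ A.ncard ≤ N := by
  have hfin : A.Finite := by
    by_contra hinf
    obtain ⟨s, hs, hc⟩ := Set.Infinite.exists_subset_card_eq hinf (N + 1)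
    have := h s hs
    omega
  refine ⟨hfin, ?_⟩
  rw [Set.ncard_eq_toFinset_card A hfin]
  exact h _ (by simp)

/-! ### Cutoff functions varying along finite trees -/

section Cutoff

variable {X : Type*} [MetricSpace X]

/-- The points at distance `3ε/2` from `x` lying on a segment from `x` to some point at
distance `2ε`. -/
def shell (x : X) (ε : ℝ) : Set X :=
  {p | dist x p = 3 * ε / 2 ∧ ∃ y, dist x y = 2 * ε ∧ p ∈ between x y}

/-- The subtree spanned by `x` and its shell. -/
def shellTree (x : X) (ε : ℝ) : Set X := ⋃ p ∈ shell x ε, between x p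

/-- A cutoff function equal to `1` on `B(x, ε)` and to `0` outside `B(x, 2ε)`, which varies only
along the finite tree `shellTree x ε`. -/
def cutoff (x : X) (ε : ℝ) (y : X) : ℝ :=
  if dist x y < 2 * ε then min 1 (3 / 2 - (dist x y - infDist y (shell x ε)) / ε) else 0

variable {x : X} {ε R : ℝ}

theorem le_infDist_shell (hne : (shell x ε).Nonempty) (y : X) :
    |dist x y - 3 * ε / 2| ≤ infDist y (shell x ε) := by
  refine (le_infDist hne).2 fun p hp => ?_
  rw [abs_le, ← hp.1]
  have h1 := dist_triangle x y p
  have h2 := dist_triangle_right x y p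
  exact ⟨by linarith, by linarith⟩

theorem cutoff_of_le {y : X} (h : 2 * ε ≤ dist x y) : cutoff x ε y = 0 := if_neg (not_lt.2 h)

theorem cutoff_of_lt (hε : 0 < ε) (hne : (shell x ε).Nonempty) {y : X} (h : dist x y < ε) :
    cutoff x ε y = 1 := by
  rw [cutoff, if_pos (by linarith), min_eq_left]
  have h1 := (neg_abs_le _).trans' (neg_le_neg (le_infDist_shell hne y))
  have : (dist x y - infDist y (shell x ε)) / ε ≤ 1 / 2 := by
    rw [div_le_iff₀ hε]; linarith
  linarith

theorem cutoff_nonneg (hε : 0 < ε) (hne : (shell x ε).Nonempty) (y : X) : 0 ≤ cutoff x ε y := by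
  rw [cutoff]
  split_ifs
  · refine le_min zero_le_one ?_
    have h1 := (le_abs_self _).trans (le_infDist_shell hne y)
    have : (dist x y - infDist y (shell x ε)) / ε ≤ 3 / 2 := by
      rw [div_le_iff₀ hε]; linarith
    linarith
  · exact le_rfl

theorem cutoff_le_one (y : X) : cutoff x ε y ≤ 1 := by
  rw [cutoff]
  split_ifs
  · exact min_le_left _ _
  · exact zero_le_one

theorem exists_mem_shell (hB : IsTreeSet (ball x R)) (hε : 0 < ε) {y : X} (hy : y ∈ ball x R)
    (h : 2 * ε ≤ dist x y) : ∃ p ∈ shell x ε, dist p y = dist x y - 3 * ε / 2 := by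
  obtain ⟨φ, hφ, -, -⟩ := hB.exists_geodesic x (mem_ball_self (dist_nonneg.trans_lt hy)) y hy
  have h1 : 3 * ε / 2 ∈ Icc 0 (dist x y) := ⟨by linarith, by linarith⟩
  have h2 : 2 * ε ∈ Icc 0 (dist x y) := ⟨by linarith, by linarith⟩
  refine ⟨φ (3 * ε / 2), ⟨hφ.dist_left h1, φ (2 * ε), hφ.dist_left h2, ?_⟩, hφ.dist_right h1⟩
  refine (hφ.restrict h2).mem_between ?_
  rw [hφ.dist_left h2]
  exact ⟨by linarith, by linarith⟩

/-- If g is the largest Gromov product (y | p) at x over shell points p, then d(x, y) minus the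
distance to the shell is 2g - 3ε/2, so the formula reads min(1, 3 - 2g/ε). A point y of the tree
ball at distance at least 2ε lies behind a shell point; there g = 3ε/2 and the formula already gives
0, so truncation creates no jump. -/
theorem cutoff_eq_of_mem_ball (hB : IsTreeSet (ball x R)) (hε : 0 < ε)
    (hne : (shell x ε).Nonempty) {y : X} (hy : y ∈ ball x R) :
    cutoff x ε y = min 1 (3 / 2 - (dist x y - infDist y (shell x ε)) / ε) := by
  by_cases h : dist x y < 2 * ε
  · rw [cutoff, if_pos h]
  rw [not_lt] at h
  rw [cutoff_of_le h]
  obtain ⟨p, hp, hpy⟩ := exists_mem_shell hB hε hy h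
  have h1 := infDist_le_dist_of_mem (x := y) hp
  rw [dist_comm, hpy] at h1
  have h2 := (le_abs_self _).trans (le_infDist_shell hne y)
  have h3 : infDist y (shell x ε) = dist x y - 3 * ε / 2 := le_antisymm h1 h2
  rw [h3, show (dist x y - (dist x y - 3 * ε / 2)) / ε = 3 / 2 by field_simp; ring]
  norm_num

/-- The slope 2 / ε comes from two 1-Lipschitz functions, the distance to x and the distance to the
shell. Since 3ε ≤ R, two points less than ε apart are both in the tree ball as soon as one is within
2ε of x. -/
theorem abs_cutoff_sub_le (hB : IsTreeSet (ball x R)) (hε : 0 < ε) (hR : 3 * ε ≤ R)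
    (hne : (shell x ε).Nonempty) {u v : X} (huv : dist u v < ε) :
    |cutoff x ε u - cutoff x ε v| ≤ 2 / ε * dist u v := by
  have main : ∀ u v : X, dist u v < ε → dist x u < 2 * ε →
      |cutoff x ε u - cutoff x ε v| ≤ 2 / ε * dist u v := by
    intro u v huv h
    have hu : u ∈ ball x R := by rw [mem_ball, dist_comm]; linarith
    have hv : v ∈ ball x R := by
      rw [mem_ball, dist_comm]; linarith [dist_triangle x u v]
    rw [cutoff_eq_of_mem_ball hB hε hne hu, cutoff_eq_of_mem_ball hB hε hne hv]
    refine (abs_min_sub_min_le_max _ _ _ _).trans (max_le (by simp; positivity) ?_)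
    have h1 := abs_dist_sub_le u v x
    have h2 := (lipschitz_infDist_pt (shell x ε)).dist_le_mul u v
    rw [Real.dist_eq, NNReal.coe_one, one_mul] at h2
    rw [dist_comm u x, dist_comm v x] at h1
    rw [abs_le] at h1 h2
    have e : 3 / 2 - (dist x u - infDist u (shell x ε)) / ε -
        (3 / 2 - (dist x v - infDist v (shell x ε)) / ε) =
        ((infDist u (shell x ε) - infDist v (shell x ε)) - (dist x u - dist x v)) / ε := by
      ring
    rw [e, abs_div, abs_of_pos hε, div_mul_eq_mul_div, div_le_div_iff_of_pos_right hε, abs_le]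
    exact ⟨by linarith [h1.1, h1.2, h2.1, h2.2], by linarith [h1.1, h1.2, h2.1, h2.2]⟩
  by_cases h : dist x u < 2 * ε
  · exact main u v huv h
  by_cases h' : dist x v < 2 * ε
  · rw [abs_sub_comm, dist_comm]
    exact main v u (by rwa [dist_comm]) h'
  rw [cutoff_of_le (not_lt.1 h), cutoff_of_le (not_lt.1 h'), sub_self, abs_zero]
  positivity

/-- A small neighbourhood of a point off the finite tree hangs from the same branch point as that
point. Moving within it changes the distance to x and to every shell point by the same amount. -/
theorem eventually_cutoff_eq (hB : IsTreeSet (ball x R)) (hε : 0 < ε) (hR : 3 * ε ≤ R)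
    (hne : (shell x ε).Nonempty) (hfin : (shell x ε).Finite) {z : X} (hz : z ∉ shellTree x ε) :
    ∀ᶠ u in 𝓝 z, cutoff x ε u = cutoff x ε z := by
  by_cases hzR : z ∈ ball x R
  swap
  · have h1 : 2 * ε < dist x z := by rw [mem_ball, dist_comm, not_lt] at hzR; linarith
    have : ∀ᶠ u in 𝓝 z, 2 * ε < dist x u :=
      (continuous_const.dist continuous_id).continuousAt.eventually (lt_mem_nhds h1)
    filter_upwards [this] with u hu
    rw [cutoff_of_le hu.le, cutoff_of_le h1.le]
  have hx : x ∈ ball x R := mem_ball_self (by linarith)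
  have hev : ∀ p ∈ shell x ε, ∀ᶠ u in 𝓝 z, u ∈ ball x R →
      dist u p - dist x u = dist z p - dist x z := by
    intro p hp
    have hpR : p ∈ ball x R := by rw [mem_ball, dist_comm, hp.1]; linarith
    -- For u within this distance of z, the product (z | u) at x exceeds (z | p). Hyperbolicity then
    -- gives (u | p) = (z | p).
    have hδ : 0 < (dist x z + dist z p - dist x p) / 2 := by
      have h1 := dist_triangle x z p
      have h2 : dist x z + dist z p ≠ dist x p := fun h => hz (mem_biUnion hp h)
      have := lt_of_le_of_ne h1 h2.symm
      linarith
    filter_upwards [ball_mem_nhds z hδ] with u hu huR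
    rw [mem_ball] at hu
    have k1 := hB.hyperbolic x hx z hzR u huR p hpR
    have k2 := hB.hyperbolic x hx u huR z hzR p hpR
    have tr := dist_triangle_right x z u
    have tr' := dist_triangle x u z
    simp only [gromovProd, dist_comm z u] at k1 k2 tr
    refine le_antisymm ?_ ?_
    · rcases min_le_iff.1 k2 with k | k <;> linarith
    · rcases min_le_iff.1 k1 with k | k <;> linarith
  have hall := (Filter.eventually_all_finite hfin).2 hev
  filter_upwards [hall, isOpen_ball.mem_nhds hzR] with u hu huR
  rw [cutoff_eq_of_mem_ball hB hε hne huR, cutoff_eq_of_mem_ball hB hε hne hzR]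
  have hinf : infDist u (shell x ε) - dist x u = infDist z (shell x ε) - dist x z := by
    refine le_antisymm ?_ ?_
    · have : infDist u (shell x ε) - dist x u + dist x z ≤ infDist z (shell x ε) :=
        (le_infDist hne).2 fun p hp => by
          have h1 := infDist_le_dist_of_mem (x := u) hp
          have h2 := hu p hp huR
          linarith
      linarith
    · have : infDist z (shell x ε) - dist x z + dist x u ≤ infDist u (shell x ε) :=
        (le_infDist hne).2 fun p hp => by
          have h1 := infDist_le_dist_of_mem (x := z) hp
          have h2 := hu p hp huR
          linarith
      linarith
  rw [show dist x u - infDist u (shell x ε) = dist x z - infDist z (shell x ε) by linarith]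

/-- Distinct points of the shell have descendants which are `ε` apart. -/
theorem eq_of_mem_shell (hB : IsTreeSet (ball x R)) (hε : 0 < ε) (hR : 3 * ε ≤ R) {p p' y y' : X}
    (hp : dist x p = 3 * ε / 2) (hp' : dist x p' = 3 * ε / 2) (hy : dist x y = 2 * ε)
    (hy' : dist x y' = 2 * ε) (h : p ∈ between x y) (h' : p' ∈ between x y')
    (hd : dist y y' < ε) : p = p' := by
  change dist x p + dist p y = dist x y at h
  change dist x p' + dist p' y' = dist x y' at h'
  have hmem : ∀ w, dist x w ≤ 2 * ε → w ∈ ball x R := by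
    intro w hw; rw [mem_ball, dist_comm]; linarith
  have hx := hmem x (by rw [dist_self]; linarith)
  have k1 := hB.hyperbolic x hx p (hmem p (by linarith)) y (hmem y hy.le) y' (hmem y' hy'.le)
  have k2 := hB.hyperbolic x hx p (hmem p (by linarith)) y' (hmem y' hy'.le) p'
    (hmem p' (by linarith))
  simp only [gromovProd, dist_comm y' p'] at k1 k2
  rw [hp, hy, hy'] at k1
  rw [hp, hp', hy'] at k2
  rw [hp, hy] at h
  rw [hp', hy'] at h'
  have k3 : dist p y' ≤ ε / 2 := by
    rcases min_le_iff.1 k1 with k | k <;> linarith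
  refine dist_le_zero.1 ?_
  rcases min_le_iff.1 k2 with k | k <;> linarith

/-- Each shell point has a descendant at distance 2ε from x, and descendants of distinct shell
points are ε apart. The shell therefore injects into an ε-separated set, which packing controls. -/
theorem shell_finite (hB : IsTreeSet (ball x R)) (hε : 0 < ε) (hR : 3 * ε ≤ R) {N : ℕ}
    (hpack : ∀ s : Finset X, (∀ u ∈ s, dist u x < 6 * ε) →
      (∀ u ∈ s, ∀ v ∈ s, u ≠ v → ε ≤ dist u v) → s.card ≤ N) :
    (shell x ε).Finite ∧ (shell x ε).ncard ≤ N := by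
  classical
  refine finite_and_ncard_le fun s hs => ?_
  have hex : ∀ p : X, ∃ y, p ∈ s → dist x y = 2 * ε ∧ p ∈ between x y := by
    intro p
    by_cases h : p ∈ s
    · obtain ⟨y, hy⟩ := (hs h).2
      exact ⟨y, fun _ => hy⟩
    · exact ⟨x, fun h' => (h h').elim⟩
  choose y hy using hex
  have hsep : ∀ p ∈ s, ∀ p' ∈ s, p ≠ p' → ε ≤ dist (y p) (y p') := by
    intro p hp p' hp' hne
    by_contra hlt
    exact hne (eq_of_mem_shell hB hε hR (hs hp).1 (hs hp').1 (hy p hp).1 (hy p' hp').1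
      (hy p hp).2 (hy p' hp').2 (not_le.1 hlt))
  have hinj : Set.InjOn y s := by
    intro p hp p' hp' h
    by_contra hne
    have := hsep p hp p' hp' hne
    rw [h, dist_self] at this
    linarith
  rw [← Finset.card_image_of_injOn hinj]
  refine hpack _ ?_ ?_
  · intro u hu
    obtain ⟨p, hp, rfl⟩ := Finset.mem_image.1 hu
    rw [dist_comm, (hy p hp).1]; linarith
  · intro u hu v hv huv
    obtain ⟨p, hp, rfl⟩ := Finset.mem_image.1 hu
    obtain ⟨p', hp', rfl⟩ := Finset.mem_image.1 hv
    exact hsep p hp p' hp' fun h => huv (by rw [h])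

theorem isClosed_shellTree (hfin : (shell x ε).Finite) : IsClosed (shellTree x ε) :=
  hfin.isClosed_biUnion fun p _ => isClosed_between x p

theorem lengthMeasure_between_le [MeasurableSpace X] [BorelSpace X] {ι : X → ℝ} {p : X}
    (hB : IsRealTree (ball x (ι x))) (hp : p ∈ ball x (ι x)) :
    lengthMeasure ι (between x p) ≤ ENNReal.ofReal (dist x p) := by
  have hsub : between x p ⊆ openSeg x p ∪ {x, p} := by
    rw [openSeg_eq_between_diff (isTreeSet_of_isRealTree hB) hp]
    intro z hz
    by_cases h : z ∈ ({x, p} : Set X)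
    · exact Or.inr h
    · exact Or.inl ⟨hz, h⟩
  have hnull : lengthMeasure ι {x, p} = 0 := by
    have := Measure.nullSingletonClass_hausdorff X (d := 1) one_pos
    refine le_antisymm ((Measure.restrict_apply_le _ _).trans_eq ?_) zero_le
    exact (Set.toFinite {x, p}).measure_zero _
  refine (measure_mono hsub).trans ((measure_union_le _ _).trans_eq ?_)
  rw [hnull, add_zero, lengthMeasure_openSeg ι x p hp hB]

theorem lengthMeasure_shellTree_le [MeasurableSpace X] [BorelSpace X] {ι : X → ℝ}
    (hB : IsRealTree (ball x (ι x))) (hε : 0 < ε) (hR : 3 * ε ≤ ι x) {N : ℕ}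
    (hfin : (shell x ε).Finite ∧ (shell x ε).ncard ≤ N) :
    lengthMeasure ι (shellTree x ε) ≤ ENNReal.ofReal (N * (3 * ε / 2)) := by
  have h1 : shellTree x ε = ⋃ p ∈ hfin.1.toFinset, between x p := by
    simp [shellTree]
  rw [h1]
  refine (measure_biUnion_finset_le _ _).trans ?_
  have h2 : ∀ p ∈ hfin.1.toFinset,
      lengthMeasure ι (between x p) ≤ ENNReal.ofReal (3 * ε / 2) := by
    intro p hp
    have hp' := (hfin.1.mem_toFinset.1 hp).1
    rw [← hp']
    refine lengthMeasure_between_le hB ?_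
    rw [mem_ball, dist_comm, hp']; linarith
  refine (Finset.sum_le_card_nsmul _ _ _ h2).trans ?_
  rw [← Set.ncard_eq_toFinset_card _ hfin.1, nsmul_eq_mul, ENNReal.ofReal_mul (by positivity),
    ENNReal.ofReal_natCast]
  gcongr
  exact hfin.2

end Cutoff

/-! ### Weighted means -/

section Average

variable {J : Type*} {T : Finset J} {a φ ψ : J → ℝ}

/-- The average of `a` with weights `φ`. -/
def weightedMean (T : Finset J) (φ a : J → ℝ) : ℝ := (∑ j ∈ T, φ j * a j) / ∑ j ∈ T, φ j

theorem weightedMean_sub (h : 1 ≤ ∑ j ∈ T, φ j) (c : ℝ) :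
    weightedMean T φ a - c = (∑ j ∈ T, φ j * (a j - c)) / ∑ j ∈ T, φ j := by
  have h0 : ∑ j ∈ T, φ j ≠ 0 := by linarith
  simp_rw [weightedMean, mul_sub, Finset.sum_sub_distrib, ← Finset.sum_mul]
  field_simp

theorem abs_weightedMean_sub_le (h : 1 ≤ ∑ j ∈ T, φ j) (h0 : ∀ j ∈ T, 0 ≤ φ j)
    (h1 : ∀ j ∈ T, φ j ≤ 1) (c : ℝ) :
    |weightedMean T φ a - c| ≤ ∑ j ∈ T, |a j - c| := by
  rw [weightedMean_sub h, abs_div, abs_of_pos (zero_lt_one.trans_le h)]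
  refine (div_le_self (abs_nonneg _) h).trans ((Finset.abs_sum_le_sum_abs _ _).trans ?_)
  refine Finset.sum_le_sum fun j hj => ?_
  rw [abs_mul, abs_of_nonneg (h0 j hj)]
  exact mul_le_of_le_one_left (abs_nonneg _) (h1 j hj)

/-- A discrete quotient rule: numerator and denominator each contribute the oscillation of a about c
times the variation of the weights. The total weight being at least 1, division does no harm. -/
theorem abs_weightedMean_sub_weightedMean_le (hφ : 1 ≤ ∑ j ∈ T, φ j) (hψ : 1 ≤ ∑ j ∈ T, ψ j)
    (h0 : ∀ j ∈ T, 0 ≤ ψ j) (h1 : ∀ j ∈ T, ψ j ≤ 1) (c : ℝ) :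
    |weightedMean T φ a - weightedMean T ψ a| ≤
      2 * (∑ j ∈ T, |a j - c|) * ∑ j ∈ T, |φ j - ψ j| := by
  set M := ∑ j ∈ T, |a j - c| with hM
  have hφ0 := zero_lt_one.trans_le hφ
  have e : weightedMean T φ a - weightedMean T ψ a =
      ((∑ j ∈ T, (φ j - ψ j) * (a j - c)) -
        (weightedMean T ψ a - c) * ∑ j ∈ T, (φ j - ψ j)) / ∑ j ∈ T, φ j := by
    have h2 := weightedMean_sub (a := a) hφ c
    have h3 := weightedMean_sub (a := a) hψ c
    have hψ0 : ∑ j ∈ T, ψ j ≠ 0 := by linarith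
    have hφ0' := hφ0.ne'
    rw [eq_div_iff hφ0'] at h2
    rw [eq_div_iff hψ0] at h3
    rw [eq_div_iff hφ0']
    simp_rw [sub_mul (φ _), Finset.sum_sub_distrib]
    linear_combination h2 - h3
  have hM1 : |∑ j ∈ T, (φ j - ψ j) * (a j - c)| ≤ M * ∑ j ∈ T, |φ j - ψ j| := by
    refine (Finset.abs_sum_le_sum_abs _ _).trans ?_
    rw [Finset.mul_sum]
    refine Finset.sum_le_sum fun j hj => ?_
    rw [abs_mul, mul_comm]
    gcongr
    exact Finset.single_le_sum (f := fun j => |a j - c|) (fun i _ => abs_nonneg _) hj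
  have hM2 : |(weightedMean T ψ a - c) * ∑ j ∈ T, (φ j - ψ j)| ≤
      M * ∑ j ∈ T, |φ j - ψ j| := by
    rw [abs_mul]
    have hM0 : 0 ≤ M := Finset.sum_nonneg fun _ _ => abs_nonneg _
    gcongr
    · exact abs_weightedMean_sub_le hψ h0 h1 c
    · exact Finset.abs_sum_le_sum_abs _ _
  rw [e, abs_div, abs_of_pos hφ0]
  refine (div_le_self (abs_nonneg _) hφ).trans ((abs_sub _ _).trans ?_)
  linarith

end Average

/-! ### Separated nets, packing and smoothing -/

section Net

variable {X : Type*} [MetricSpace X]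

theorem exists_maximal_separated (X : Type*) [MetricSpace X] (ε : ℝ) : ∃ V : Set X,
    (∀ u ∈ V, ∀ v ∈ V, u ≠ v → ε ≤ dist u v) ∧ (0 < ε → ∀ x, ∃ v ∈ V, dist v x < ε) := by
  obtain ⟨V, hV⟩ := zorn_subset {V : Set X | ∀ u ∈ V, ∀ v ∈ V, u ≠ v → ε ≤ dist u v} (by
    intro c hc hchain
    refine ⟨⋃₀ c, ?_, fun s hs => subset_sUnion_of_mem hs⟩
    rintro u ⟨s, hs, hus⟩ v ⟨t, ht, hvt⟩ huv
    rcases hchain.total hs ht with h | h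
    · exact hc ht u (h hus) v hvt huv
    · exact hc hs u hus v (h hvt) huv)
  refine ⟨V, hV.prop, fun hε x => ?_⟩
  by_contra hcon
  push Not at hcon
  have hins : insert x V ∈ {V : Set X | ∀ u ∈ V, ∀ v ∈ V, u ≠ v → ε ≤ dist u v} := by
    rintro u (rfl | hu) v (rfl | hv) huv
    · exact (huv rfl).elim
    · rw [dist_comm]; exact hcon v hv
    · exact hcon u hu
    · exact hV.prop u hu v hv huv
  have hx := hV.le_of_ge hins (subset_insert x V) (mem_insert x V)
  have := hcon x hx
  rw [dist_self] at this
  linarith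

/-- The balls of radius ε/2 about the points are disjoint and contained in B(x, 7ε), so comparing
volumes bounds their number. -/
theorem card_le_of_measure_ball [MeasurableSpace X] [OpensMeasurableSpace X] {m : Measure X}
    {ε : ℝ} {a b : ℝ≥0∞} {N : ℕ} (ha0 : a ≠ 0) (hat : a ≠ ∞)
    (ha : ∀ x, a ≤ m (ball x (ε / 2))) (hb : ∀ x, m (ball x (7 * ε)) ≤ b) (hab : b ≤ N * a)
    (hε : 0 < ε) {x : X} (s : Finset X) (hs : ∀ u ∈ s, dist u x < 6 * ε)
    (hsep : ∀ u ∈ s, ∀ v ∈ s, u ≠ v → ε ≤ dist u v) : s.card ≤ N := by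
  have hdisj : Set.PairwiseDisjoint (s : Set X) fun u => ball u (ε / 2) := by
    intro u hu v hv huv
    exact ball_disjoint_ball (by have := hsep u hu v hv huv; linarith)
  have h1 : (s.card : ℝ≥0∞) * a ≤ N * a := by
    calc (s.card : ℝ≥0∞) * a = ∑ u ∈ s, a := by rw [Finset.sum_const, nsmul_eq_mul]
      _ ≤ ∑ u ∈ s, m (ball u (ε / 2)) := Finset.sum_le_sum fun u _ => ha u
      _ = m (⋃ u ∈ s, ball u (ε / 2)) :=
          (measure_biUnion_finset hdisj fun u _ => measurableSet_ball).symm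
      _ ≤ m (ball x (7 * ε)) := by
          refine measure_mono (iUnion₂_subset fun u hu => ball_subset_ball' ?_)
          linarith [hs u hu]
      _ ≤ N * a := (hb x).trans hab
  exact_mod_cast (ENNReal.mul_le_mul_iff_left ha0 hat).1 h1

/-- The partition-of-unity average of the values `a v`, `v ∈ V`, at scale `ε`. -/
def smoothing (V : Set X) (ε : ℝ) (a : X → ℝ) (u : X) : ℝ :=
  (∑ᶠ v ∈ V, cutoff v ε u * a v) / ∑ᶠ v ∈ V, cutoff v ε u

variable {V : Set X} {ε : ℝ} {T : Finset X} {k : X}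

/-- A cutoff centred at v vanishes at u unless d(v, u) < 2ε, and then d(v, k) < 4ε. The `finsum`s
thus have finite support and are genuine sums, over one index set for all u in B(k, 2ε). -/
theorem smoothing_eq (hT : ∀ v, v ∈ T ↔ v ∈ V ∧ dist v k < 4 * ε) (a : X → ℝ) {u : X}
    (hu : dist k u < 2 * ε) :
    smoothing V ε a u = weightedMean T (fun v => cutoff v ε u) a := by
  have key : ∀ g : X → ℝ, (∀ v, cutoff v ε u = 0 → g v = 0) →
      ∑ᶠ v ∈ V, g v = ∑ v ∈ T, g v := by
    intro g hg
    refine finsum_mem_eq_sum_of_inter_support_eq _ ?_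
    ext v
    simp only [mem_inter_iff, Function.mem_support, Finset.mem_coe, hT, and_congr_left_iff,
      iff_self_and]
    intro hv _
    have h1 : dist v u < 2 * ε := by
      by_contra h
      exact hv (hg v (cutoff_of_le (not_lt.1 h)))
    have := dist_triangle_right v k u
    linarith
  rw [smoothing, weightedMean, key _ fun v hv => by rw [hv, zero_mul], key _ fun v hv => hv]

theorem one_le_sum_cutoff (hε : 0 < ε) (hne : ∀ x : X, (shell x ε).Nonempty)
    (hV : ∀ x, ∃ v ∈ V, dist v x < ε) (hT : ∀ v, v ∈ T ↔ v ∈ V ∧ dist v k < 4 * ε) {u : X}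
    (hu : dist k u < 2 * ε) : 1 ≤ ∑ v ∈ T, cutoff v ε u := by
  obtain ⟨v, hv, hvu⟩ := hV u
  have hvT : v ∈ T := by
    rw [hT]
    have := dist_triangle_right v k u
    exact ⟨hv, by linarith⟩
  rw [← cutoff_of_lt hε (hne v) hvu]
  exact Finset.single_le_sum (f := fun v => cutoff v ε u)
    (fun w _ => cutoff_nonneg hε (hne w) u) hvT

theorem abs_smoothing_sub_le (hε : 0 < ε) (hne : ∀ x : X, (shell x ε).Nonempty)
    (hV : ∀ x, ∃ v ∈ V, dist v x < ε) (hT : ∀ v, v ∈ T ↔ v ∈ V ∧ dist v k < 4 * ε)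
    (a : X → ℝ) {u : X} (hu : dist k u < 2 * ε) (c : ℝ) :
    |smoothing V ε a u - c| ≤ ∑ v ∈ T, |a v - c| := by
  rw [smoothing_eq hT a hu]
  exact abs_weightedMean_sub_le (one_le_sum_cutoff hε hne hV hT hu)
    (fun v _ => cutoff_nonneg hε (hne v) u) (fun v _ => cutoff_le_one u) c

theorem abs_smoothing_sub_smoothing_le (hε : 0 < ε) (hne : ∀ x : X, (shell x ε).Nonempty)
    (hV : ∀ x, ∃ v ∈ V, dist v x < ε) (hT : ∀ v, v ∈ T ↔ v ∈ V ∧ dist v k < 4 * ε)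
    (a : X → ℝ) {u w : X} (hu : dist k u < 2 * ε) (hw : dist k w < 2 * ε) (c : ℝ) :
    |smoothing V ε a u - smoothing V ε a w| ≤
      2 * (∑ v ∈ T, |a v - c|) * ∑ v ∈ T, |cutoff v ε u - cutoff v ε w| := by
  rw [smoothing_eq hT a hu, smoothing_eq hT a hw]
  exact abs_weightedMean_sub_weightedMean_le (one_le_sum_cutoff hε hne hV hT hu)
    (one_le_sum_cutoff hε hne hV hT hw) (fun v _ => cutoff_nonneg hε (hne v) w)
    (fun v _ => cutoff_le_one w) c

variable {ι : X → ℝ} {N : ℕ}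

theorem exists_lipschitzOnWith_smoothing (htree : ∀ x, IsTreeSet (ball x (ι x))) (hε : 0 < ε)
    (hι : ∀ x, 3 * ε ≤ ι x) (hne : ∀ x : X, (shell x ε).Nonempty)
    (hV : ∀ x, ∃ v ∈ V, dist v x < ε) (hT : ∀ v, v ∈ T ↔ v ∈ V ∧ dist v k < 4 * ε)
    (hTN : T.card ≤ N) (a : X → ℝ) {z : X} (hz : dist k z < ε) (c : ℝ) :
    ∃ s ∈ 𝓝 z, LipschitzOnWith (Real.toNNReal (4 * N / ε * ∑ v ∈ T, |a v - c|))
      (smoothing V ε a) s := by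
  have hM : 0 ≤ ∑ v ∈ T, |a v - c| := Finset.sum_nonneg fun _ _ => abs_nonneg _
  refine ⟨ball z (ε / 2), ball_mem_nhds z (by linarith), ?_⟩
  refine LipschitzOnWith.of_dist_le_mul fun u hu w hw => ?_
  rw [mem_ball, dist_comm] at hu hw
  have huw := dist_triangle_left u w z
  have hku := dist_triangle k z u
  have hkw := dist_triangle k z w
  rw [Real.coe_toNNReal _ (by positivity), Real.dist_eq]
  refine (abs_smoothing_sub_smoothing_le hε hne hV hT a (by linarith) (by linarith) c).trans ?_
  have h1 : ∑ v ∈ T, |cutoff v ε u - cutoff v ε w| ≤ N * (2 / ε * dist u w) := by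
    refine (Finset.sum_le_card_nsmul _ _ (2 / ε * dist u w) fun v _ =>
      abs_cutoff_sub_le (htree v) hε (hι v) (hne v) (by linarith)).trans ?_
    rw [nsmul_eq_mul]
    gcongr
  calc 2 * (∑ v ∈ T, |a v - c|) * ∑ v ∈ T, |cutoff v ε u - cutoff v ε w|
      ≤ 2 * (∑ v ∈ T, |a v - c|) * (N * (2 / ε * dist u w)) := by gcongr
    _ = 4 * N / ε * (∑ v ∈ T, |a v - c|) * dist u w := by ring

theorem exists_lipschitzOnWith_zero_smoothing (htree : ∀ x, IsTreeSet (ball x (ι x)))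
    (hε : 0 < ε) (hι : ∀ x, 3 * ε ≤ ι x) (hne : ∀ x : X, (shell x ε).Nonempty)
    (hfin : ∀ x : X, (shell x ε).Finite)
    (hT : ∀ v, v ∈ T ↔ v ∈ V ∧ dist v k < 4 * ε)
    (a : X → ℝ) {z : X} (hz : dist k z < ε) (hzA : ∀ v ∈ T, z ∉ shellTree v ε) :
    ∃ s ∈ 𝓝 z, LipschitzOnWith 0 (smoothing V ε a) s := by
  have h1 : ∀ᶠ u in 𝓝 z, ∀ v ∈ T, cutoff v ε u = cutoff v ε z :=
    (Finset.eventually_all T).2 fun v hv =>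
      eventually_cutoff_eq (htree v) hε (hι v) (hne v) (hfin v) (hzA v hv)
  have h2 : ∀ᶠ u in 𝓝 z, dist k u < 2 * ε :=
    (continuous_const.dist continuous_id).continuousAt.eventually
      (gt_mem_nhds (show dist k z < 2 * ε by linarith))
  refine ⟨_, h1.and h2, LipschitzOnWith.of_dist_le_mul fun u hu w hw => ?_⟩
  rw [smoothing_eq hT a hu.2, smoothing_eq hT a hw.2, weightedMean, weightedMean,
    Finset.sum_congr rfl fun v hv => by rw [hu.1 v hv, ← hw.1 v hv],
    Finset.sum_congr rfl fun v hv => (hu.1 v hv).trans (hw.1 v hv).symm]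
  simp

end Net

/-! ### Bounded overlap and deviation of averages -/

section Measure

variable {X : Type*} [MeasurableSpace X] {m : Measure X}

theorem sum_restrict_le {J : Type*} [Countable J] {B : J → Set X}
    (hB : ∀ j, MeasurableSet (B j)) {N : ℕ}
    (h : ∀ (x : X) (s : Finset J), (∀ j ∈ s, x ∈ B j) → s.card ≤ N) :
    Measure.sum (fun j => m.restrict (B j)) ≤ (N : ℝ≥0∞) • m := by
  classical
  refine Measure.le_iff.2 fun s hs => ?_
  rw [Measure.sum_apply _ hs, Measure.smul_apply, smul_eq_mul]
  have h1 : ∀ j, m.restrict (B j) s = ∫⁻ x in s, (B j).indicator 1 x ∂m := by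
    intro j
    rw [lintegral_indicator_one (hB j), Measure.restrict_apply hs,
      Measure.restrict_apply (hB j), inter_comm]
  simp_rw [h1]
  rw [← lintegral_tsum fun j => (measurable_one.indicator (hB j)).aemeasurable]
  calc ∫⁻ x in s, ∑' j, (B j).indicator 1 x ∂m ≤ ∫⁻ _ in s, (N : ℝ≥0∞) ∂m := by
        refine lintegral_mono fun x => ?_
        simp only
        rw [ENNReal.tsum_eq_iSup_sum]
        refine iSup_le fun t => ?_
        simp only [indicator_apply, Pi.one_apply, Finset.sum_boole]
        exact_mod_cast h x _ fun j hj => (Finset.mem_filter.1 hj).2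
    _ = N * m s := by rw [setLIntegral_const]

theorem enorm_sub_setAverage_le {f : X → ℝ} {B : Set X} (h0 : m B ≠ 0) (ht : m B ≠ ∞)
    (hf : IntegrableOn f B m) (c : ℝ) :
    ‖(⨍ y in B, f y ∂m) - c‖ₑ ≤ (m B)⁻¹ * ∫⁻ y in B, ‖f y - c‖ₑ ∂m := by
  have h1 : (⨍ y in B, f y ∂m) - c = ⨍ y in B, (f y - c) ∂m := by
    have hfin : IsFiniteMeasure (m.restrict B) := ⟨by simpa using lt_top_iff_ne_top.2 ht⟩
    have hne : NeZero (m.restrict B) := ⟨by simpa using h0⟩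
    conv_lhs => rw [← average_const (m.restrict B) c]
    rw [average, average, average, ← integral_sub]
    · exact hf.smul_measure (by simpa using h0)
    · exact (integrable_const c).smul_measure (by simpa using h0)
  rw [h1, average]
  refine (enorm_integral_le_lintegral_enorm _).trans_eq ?_
  rw [lintegral_smul_measure, Measure.restrict_apply_univ, smul_eq_mul]

end Measure

/-! ### Approximation at a fixed scale -/

section Approximation

variable {X : Type*} [MetricSpace X] [MeasurableSpace X] [BorelSpace X]
  [TopologicalSpace.SeparableSpace X] {m : Measure X} {ι : X → ℝ}

/-- Approximation at scale `ε` by absolutely continuous functions, with control of the gradient by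
the Korevaar-Schoen double integral. -/
theorem exists_approximation (htree : ∀ x, IsRealTree (ball x (ι x))) {ε : ℝ} (hε : 0 < ε)
    (hι : ∀ x, 3 * ε ≤ ι x) (hne : ∀ x : X, (shell x ε).Nonempty) {N : ℕ}
    (hpack : ∀ (x : X) (s : Finset X), (∀ u ∈ s, dist u x < 6 * ε) →
      (∀ u ∈ s, ∀ v ∈ s, u ≠ v → ε ≤ dist u v) → s.card ≤ N)
    {b : ℝ≥0∞} (hb0 : b ≠ 0) (hb : ∀ x, b ≤ m (ball x ε)) (hfin : ∀ x, m (ball x ε) ≠ ∞)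
    {f : X → ℝ} (hf : Integrable f m) :
    ∃ F : X → ℝ, IsAC ι F ∧
      (∃ h, IsAbsGradient ι F h ∧ ∫⁻ z, ‖h z‖ₑ ∂lengthMeasure ι ≤
        6 * N ^ 5 * (b⁻¹ * b⁻¹ * pairEnergy m f (6 * ε))) ∧
      ∫⁻ x, ‖F x - f x‖ₑ ∂m ≤ N * (b⁻¹ * pairEnergy m f (6 * ε)) := by
  have htree' : ∀ x, IsTreeSet (ball x (ι x)) := fun x => isTreeSet_of_isRealTree (htree x)
  have hshell := fun x => shell_finite (htree' x) hε (hι x) (hpack x)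
  obtain ⟨V, hVsep, hVnear⟩ := exists_maximal_separated X ε
  have hV := hVnear hε
  have hnear : ∀ k : X, ∃ T : Finset X, (∀ v, v ∈ T ↔ v ∈ V ∧ dist v k < 4 * ε) ∧ T.card ≤ N := by
    intro k
    obtain ⟨h1, h2⟩ := finite_and_ncard_le (A := {v ∈ V | dist v k < 4 * ε}) (N := N) fun s hs =>
      hpack k s (fun u hu => by linarith [(hs hu).2])
        fun u hu v hv => hVsep u (hs hu).1 v (hs hv).1
    exact ⟨h1.toFinset, fun v => by simp, by rwa [← Set.ncard_eq_toFinset_card _ h1]⟩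
  choose T hT hTN using hnear
  -- Every net point is within ε of a countable dense set, and each point of X has only finitely
  -- many net points within 4ε.
  have hVc : V.Countable := by
    obtain ⟨E, hEc, hEd⟩ := TopologicalSpace.exists_countable_dense X
    refine (hEc.biUnion fun e _ => (T e).countable_toSet).mono fun v hv => ?_
    obtain ⟨e, he, heE⟩ := Metric.dense_iff.1 hEd v ε hε
    rw [mem_ball, dist_comm] at he
    exact mem_biUnion heE (by rw [Finset.mem_coe, hT]; exact ⟨hv, by linarith⟩)
  set a : X → ℝ := fun v => ⨍ y in ball v ε, f y ∂m with ha
  have havg : ∀ v c, ‖a v - c‖ₑ ≤ b⁻¹ * ∫⁻ y in ball v ε, ‖f y - c‖ₑ ∂m := by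
    intro v c
    refine (enorm_sub_setAverage_le ((pos_iff_ne_zero.2 hb0).trans_le (hb v)).ne' (hfin v)
      hf.integrableOn c).trans ?_
    gcongr
    exact hb v
  set G : X → ℝ≥0∞ := fun x => ∫⁻ y in ball x (6 * ε), ‖f y - f x‖ₑ ∂m with hG
  have hsumG : ∀ k x, dist k x < ε →
      ∑ v ∈ T k, ∫⁻ y in ball v ε, ‖f y - f x‖ₑ ∂m ≤ N * G x := by
    intro k x hkx
    refine (Finset.sum_le_card_nsmul _ _ (G x) fun v hv => ?_).trans ?_
    · refine lintegral_mono_set (ball_subset_ball' ?_)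
      have := ((hT k v).1 hv).2
      linarith [dist_triangle v k x]
    · rw [nsmul_eq_mul]
      gcongr
      exact_mod_cast hTN k
  -- Both means are opened up: for x in B(k, ε), y in B(v, ε) and d(v, k) < 4ε one has d(x, y) < 6ε,
  -- which is the radius in G.
  have hmean : ∀ k, ∑ v ∈ T k, ‖a v - a k‖ₑ ≤ N * (b⁻¹ * b⁻¹ * ∫⁻ x in ball k ε, G x ∂m) := by
    intro k
    calc ∑ v ∈ T k, ‖a v - a k‖ₑ
        ≤ ∑ v ∈ T k, b⁻¹ * ∫⁻ x in ball k ε, b⁻¹ * G x ∂m := by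
          refine Finset.sum_le_sum fun v hv => ?_
          rw [← enorm_neg, neg_sub]
          refine (havg k (a v)).trans (mul_le_mul' le_rfl ?_)
          refine setLIntegral_mono' measurableSet_ball fun x hx => ?_
          rw [← enorm_neg, neg_sub]
          refine (havg v (f x)).trans (mul_le_mul' le_rfl ?_)
          refine lintegral_mono_set (ball_subset_ball' ?_)
          rw [mem_ball, dist_comm] at hx
          have := ((hT k v).1 hv).2
          linarith [dist_triangle v k x]
      _ = (T k).card * (b⁻¹ * b⁻¹ * ∫⁻ x in ball k ε, G x ∂m) := by
          rw [Finset.sum_const, nsmul_eq_mul, lintegral_const_mul' _ _ (ENNReal.inv_ne_top.2 hb0),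
            mul_assoc b⁻¹]
      _ ≤ _ := by
          gcongr
          exact_mod_cast hTN k
  have hlip : LocallyLipschitz (smoothing V ε a) := by
    intro z
    obtain ⟨s, hs, hl⟩ := exists_lipschitzOnWith_smoothing htree' hε hι hne hV (hT z) (hTN z) a
      (z := z) (by rwa [dist_self]) 0
    exact ⟨_, s, hs, hl⟩
  obtain ⟨hAC, h, hh, hbound⟩ := exists_isAbsGradient hlip htree' (ι₀ := 3 * ε) (by linarith) hι
  refine ⟨smoothing V ε a, hAC, ⟨h, hh, ?_⟩, ?_⟩
  · have hVc' := hVc.to_subtype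
    -- On B(k, ε) the gradient is at most 4N/ε times the oscillation of the means, and it vanishes
    -- off at most N finite trees, each of length at most N · 3ε/2. The scale ε cancels and leaves
    -- 6N³.
    have hloc : ∀ k, ∫⁻ z in ball k ε, ‖h z‖ₑ ∂lengthMeasure ι ≤
        6 * N ^ 3 * ∑ v ∈ T k, ‖a v - a k‖ₑ := by
      intro k
      set A : Set X := ⋃ v ∈ T k, shellTree v ε with hA
      have hAcl : MeasurableSet A :=
        Finset.measurableSet_biUnion _ fun v _ => (isClosed_shellTree (hshell v).1).measurableSet
      set K := 4 * N / ε * ∑ v ∈ T k, |a v - a k| with hK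
      have hK0 : 0 ≤ K := mul_nonneg (by positivity) (Finset.sum_nonneg fun _ _ => abs_nonneg _)
      have hpt : ∀ z ∈ ball k ε, ‖h z‖ₑ ≤ A.indicator (fun _ => ENNReal.ofReal K) z := by
        intro z hz
        rw [mem_ball, dist_comm] at hz
        rw [Real.enorm_eq_ofReal_abs]
        by_cases hzA : z ∈ A
        · rw [indicator_of_mem hzA]
          obtain ⟨s, hs, hl⟩ := exists_lipschitzOnWith_smoothing htree' hε hι hne hV (hT k)
            (hTN k) a hz (a k)
          refine ENNReal.ofReal_le_ofReal ((hbound z _ s hs hl).trans_eq ?_)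
          exact Real.coe_toNNReal _ hK0
        · rw [indicator_of_notMem hzA]
          obtain ⟨s, hs, hl⟩ := exists_lipschitzOnWith_zero_smoothing htree' hε hι hne
            (fun x => (hshell x).1) (hT k) a hz
            (fun v hv hzv => hzA (mem_biUnion hv hzv))
          have := hbound z _ s hs hl
          rw [NNReal.coe_zero] at this
          rw [ENNReal.ofReal_of_nonpos this]
      have hAν : lengthMeasure ι A ≤ ENNReal.ofReal (N * (N * (3 * ε / 2))) := by
        refine (measure_biUnion_finset_le _ _).trans ((Finset.sum_le_card_nsmul _ _ _ fun v _ =>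
          lengthMeasure_shellTree_le (htree v) hε (hι v) (hshell v)).trans ?_)
        rw [nsmul_eq_mul, ENNReal.ofReal_mul (q := N * (3 * ε / 2)) (Nat.cast_nonneg N),
          ENNReal.ofReal_natCast]
        gcongr
        exact hTN k
      calc ∫⁻ z in ball k ε, ‖h z‖ₑ ∂lengthMeasure ι
          ≤ ∫⁻ z in ball k ε, A.indicator (fun _ => ENNReal.ofReal K) z ∂lengthMeasure ι :=
            setLIntegral_mono' measurableSet_ball hpt
        _ ≤ ∫⁻ z, A.indicator (fun _ => ENNReal.ofReal K) z ∂lengthMeasure ι :=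
            setLIntegral_le_lintegral _ _
        _ = ENNReal.ofReal K * lengthMeasure ι A := by
            rw [lintegral_indicator hAcl, setLIntegral_const]
        _ ≤ ENNReal.ofReal K * ENNReal.ofReal (N * (N * (3 * ε / 2))) := by gcongr
        _ = ENNReal.ofReal (6 * N ^ 3 * ∑ v ∈ T k, |a v - a k|) := by
            rw [← ENNReal.ofReal_mul hK0, hK]
            congr 1
            field_simp
            ring
        _ = 6 * N ^ 3 * ∑ v ∈ T k, ‖a v - a k‖ₑ := by
            rw [ENNReal.ofReal_mul (by positivity), ENNReal.ofReal_sum_of_nonneg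
              fun _ _ => abs_nonneg _, ENNReal.ofReal_mul (by norm_num),
              ENNReal.ofReal_pow (Nat.cast_nonneg N), ENNReal.ofReal_natCast]
            simp_rw [Real.enorm_eq_ofReal_abs]
            norm_num
    have hcover : (univ : Set X) ⊆ ⋃ k : V, ball (k : X) ε := by
      intro x _
      obtain ⟨v, hv, hvx⟩ := hV x
      exact mem_iUnion.2 ⟨⟨v, hv⟩, by rwa [mem_ball, dist_comm]⟩
    have hover : Measure.sum (fun k : V => m.restrict (ball (k : X) ε)) ≤ (N : ℝ≥0∞) • m := by
      classical
      refine sum_restrict_le (fun k => measurableSet_ball) fun x s hs => ?_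
      rw [← Finset.card_image_of_injective s Subtype.val_injective]
      refine hpack x _ (fun u hu => ?_) fun u hu v hv => ?_
      · obtain ⟨k, hk, rfl⟩ := Finset.mem_image.1 hu
        have := hs k hk
        rw [mem_ball, dist_comm] at this
        linarith
      · obtain ⟨k, -, rfl⟩ := Finset.mem_image.1 hu
        obtain ⟨l, -, rfl⟩ := Finset.mem_image.1 hv
        exact hVsep _ k.2 _ l.2
    -- The power N⁵ collects N³ from the local bound, N from the number of neighbouring means and N
    -- from the overlap of the balls.
    calc ∫⁻ z, ‖h z‖ₑ ∂lengthMeasure ι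
        ≤ ∫⁻ z in ⋃ k : V, ball (k : X) ε, ‖h z‖ₑ ∂lengthMeasure ι := by
          rw [univ_subset_iff.1 hcover, Measure.restrict_univ]
      _ ≤ ∑' k : V, ∫⁻ z in ball (k : X) ε, ‖h z‖ₑ ∂lengthMeasure ι := lintegral_iUnion_le _ _
      _ ≤ ∑' k : V, 6 * N ^ 3 * (N * (b⁻¹ * b⁻¹ * ∫⁻ x in ball (k : X) ε, G x ∂m)) := by
          refine ENNReal.tsum_le_tsum fun k => (hloc k).trans ?_
          exact mul_le_mul' le_rfl (hmean k)
      _ = 6 * N ^ 3 * (N * (b⁻¹ * b⁻¹ * ∑' k : V, ∫⁻ x in ball (k : X) ε, G x ∂m)) := by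
          simp_rw [ENNReal.tsum_mul_left]
      _ ≤ 6 * N ^ 3 * (N * (b⁻¹ * b⁻¹ * (N * pairEnergy m f (6 * ε)))) := by
          gcongr
          rw [← lintegral_sum_measure]
          refine (lintegral_mono' hover le_rfl).trans_eq ?_
          rw [lintegral_smul_measure]
          rfl
      _ = _ := by ring
  · calc ∫⁻ x, ‖smoothing V ε a x - f x‖ₑ ∂m ≤ ∫⁻ x, (N * b⁻¹) * G x ∂m := by
          refine lintegral_mono fun x => ?_
          have h1 := abs_smoothing_sub_le hε hne hV (hT x) a (u := x)
            (by rw [dist_self]; linarith) (f x)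
          simp only
          calc ‖smoothing V ε a x - f x‖ₑ ≤ ENNReal.ofReal (∑ v ∈ T x, |a v - f x|) := by
                rw [Real.enorm_eq_ofReal_abs]; exact ENNReal.ofReal_le_ofReal h1
            _ = ∑ v ∈ T x, ‖a v - f x‖ₑ := by
                rw [ENNReal.ofReal_sum_of_nonneg fun _ _ => abs_nonneg _]
                simp_rw [Real.enorm_eq_ofReal_abs]
            _ ≤ ∑ v ∈ T x, b⁻¹ * ∫⁻ y in ball v ε, ‖f y - f x‖ₑ ∂m :=
                Finset.sum_le_sum fun v _ => havg v (f x)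
            _ = b⁻¹ * ∑ v ∈ T x, ∫⁻ y in ball v ε, ‖f y - f x‖ₑ ∂m := by rw [Finset.mul_sum]
            _ ≤ b⁻¹ * (N * G x) := by
                gcongr
                exact hsumG x x (by rwa [dist_self])
            _ = N * b⁻¹ * G x := by ring
      _ = N * (b⁻¹ * pairEnergy m f (6 * ε)) := by
          rw [lintegral_const_mul' _ _
            (ENNReal.mul_ne_top (ENNReal.natCast_ne_top N) (ENNReal.inv_ne_top.2 hb0)), mul_assoc]
          rfl

end Approximation

/-! ### Positivity and vanishing at 0 of the volume function -/

section VolumeFunction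

variable {r₀ : ℝ} {Φ : ℝ → ℝ} {α c₀ C₀ : ℝ}

theorem volumeFunction_pos (hΦ_nonneg : ∀ r ∈ Icc 0 r₀, 0 ≤ Φ r) (hc₀ : 0 < c₀)
    (hΦ : ∀ r R, 0 < r → r ≤ R → R ≤ r₀ →
      c₀ * (R / r) ≤ Φ R / Φ r ∧ Φ R / Φ r ≤ C₀ * (R / r) ^ α) {r : ℝ} (hr : 0 < r)
    (hr' : r ≤ r₀) : 0 < Φ r := by
  refine lt_of_le_of_ne (hΦ_nonneg r ⟨hr.le, hr'⟩) fun h => ?_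
  -- If Φ r were 0, the quotient Φ r / Φ r would be 0 by convention, against the lower bound c₀ > 0
  -- at R = r.
  have := (hΦ r r hr le_rfl hr').1
  rw [← h, div_zero, div_self hr.ne', mul_one] at this
  linarith

theorem tendsto_volumeFunction (hΦ_nonneg : ∀ r ∈ Icc 0 r₀, 0 ≤ Φ r) (hr₀ : 0 < r₀)
    (hc₀ : 0 < c₀)
    (hΦ : ∀ r R, 0 < r → r ≤ R → R ≤ r₀ →
      c₀ * (R / r) ≤ Φ R / Φ r ∧ Φ R / Φ r ≤ C₀ * (R / r) ^ α) :
    Tendsto Φ (𝓝[>] 0) (𝓝 0) := by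
  have hlim : Tendsto (fun r => Φ r₀ / (c₀ * r₀) * r) (𝓝[>] 0) (𝓝 0) := by
    have : Tendsto (fun r => Φ r₀ / (c₀ * r₀) * r) (𝓝 0) (𝓝 (Φ r₀ / (c₀ * r₀) * 0)) :=
      (continuous_const.mul continuous_id).tendsto 0
    rw [mul_zero] at this
    exact this.mono_left nhdsWithin_le_nhds
  have hev : ∀ᶠ r in 𝓝[>] (0 : ℝ), r ∈ Ioc 0 r₀ := Ioc_mem_nhdsGT hr₀
  refine tendsto_of_tendsto_of_tendsto_of_le_of_le' tendsto_const_nhds hlim ?_ ?_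
  · filter_upwards [hev] with r hr
    exact hΦ_nonneg r ⟨hr.1.le, hr.2⟩
  · filter_upwards [hev] with r hr
    have hpos := volumeFunction_pos hΦ_nonneg hc₀ hΦ hr.1 hr.2
    have h := (hΦ r r₀ hr.1 hr.2 le_rfl).1
    rw [le_div_iff₀ hpos] at h
    rw [div_mul_eq_mul_div, le_div_iff₀ (by positivity)]
    have hr1 := hr.1
    calc Φ r * (c₀ * r₀) = c₀ * (r₀ / r) * Φ r * r := by field_simp
      _ ≤ Φ r₀ * r := by gcongr

end VolumeFunction

/-! ### From fixed scales to the relaxation -/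

/-- A diameter above 4ε yields a point at distance at least 2ε from x. Connectedness then yields one
at distance exactly 2ε, which lies in the tree ball because 3ε ≤ R. -/
theorem shell_nonempty {X : Type*} [MetricSpace X] [ConnectedSpace X] {ε R : ℝ} {x : X}
    (hB : IsTreeSet (ball x R)) (hε : 0 < ε) (hR : 3 * ε ≤ R)
    (hdiam : ENNReal.ofReal (4 * ε) < ediam (univ : Set X)) : (shell x ε).Nonempty := by
  have hfar : ∃ y, 2 * ε ≤ dist x y := by
    by_contra hcon
    push Not at hcon
    refine hdiam.not_ge (ediam_le fun y _ z _ => ?_)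
    rw [edist_dist]
    refine ENNReal.ofReal_le_ofReal ?_
    linarith [dist_triangle_left y z x, hcon y, hcon z]
  obtain ⟨y, hy⟩ := mem_range_of_exists_le_of_exists_ge (c := 2 * ε) (f := fun y => dist x y)
    (by fun_prop) ⟨x, by simp; linarith⟩ hfar
  obtain ⟨p, hp, -⟩ := exists_mem_shell hB hε (y := y)
    (by rw [mem_ball, dist_comm]; simp only at hy; linarith) hy.ge
  exact ⟨p, hp⟩

/-- For any finite L above the liminf there are scales tending to 0 with energy below L. The
approximants at these scales have L¹ error at most A Φ(r) L → 0, so they compete in the relaxation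
with energies at most C L. -/
theorem totalVariation_le_liminf_ksEnergy {X : Type*} [MetricSpace X] [MeasurableSpace X]
    [BorelSpace X] {m : Measure X} {ι : X → ℝ} {Φ : ℝ → ℝ} {C A δ : ℝ} (hC : 0 < C) (hδ : 0 < δ)
    (hΦlim : Tendsto Φ (𝓝[>] 0) (𝓝 0))
    (h : ∀ (f : Lp ℝ 1 m) (r : ℝ), 0 < r → r < δ → ksEnergy m Φ 1 f r ≠ ∞ →
      ∃ F ∈ sobolevSpace m ι, energyOne m ι F ≤ ENNReal.ofReal C * ksEnergy m Φ 1 f r ∧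
        edist F f ≤ ENNReal.ofReal (A * Φ r) * ksEnergy m Φ 1 f r) (f : Lp ℝ 1 m) :
    totalVariation m ι f ≤
      ENNReal.ofReal C * liminf (fun r => ksEnergy m Φ 1 f r) (𝓝[>] 0) := by
  have hC0 : ENNReal.ofReal C ≠ 0 := by rwa [Ne, ENNReal.ofReal_eq_zero, not_le]
  rw [← ENNReal.div_le_iff' hC0 ENNReal.ofReal_ne_top]
  refine le_of_forall_gt_imp_ge_of_dense fun L hL => ?_
  rcases eq_or_ne L ∞ with rfl | hLtop
  · exact le_top
  rw [ENNReal.div_le_iff' hC0 ENNReal.ofReal_ne_top]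
  have hfreq := (frequently_lt_of_liminf_lt (by isBoundedDefault) hL).and_eventually
    (Ioo_mem_nhdsGT hδ)
  obtain ⟨r, hrlim, hr⟩ := exists_seq_forall_of_frequently hfreq
  choose F hFs hFe hFd using fun n => h f (r n) (hr n).2.1 (hr n).2.2 (hr n).1.ne_top
  have hlim : Tendsto F atTop (𝓝 f) := by
    rw [tendsto_iff_edist_tendsto_0]
    have h1 : Tendsto (fun n => ENNReal.ofReal (A * Φ (r n)) * L) atTop (𝓝 0) := by
      have h2 : Tendsto (fun n => ENNReal.ofReal (A * Φ (r n))) atTop (𝓝 0) := by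
        have := ENNReal.tendsto_ofReal ((hΦlim.comp hrlim).const_mul A)
        rwa [mul_zero, ENNReal.ofReal_zero] at this
      have := ENNReal.Tendsto.mul_const h2 (Or.inr hLtop)
      rwa [zero_mul] at this
    refine tendsto_of_tendsto_of_tendsto_of_le_of_le tendsto_const_nhds h1 (fun n => zero_le)
      fun n => (hFd n).trans ?_
    exact mul_le_mul' le_rfl (hr n).1.le
  refine (iInf₂_le F ⟨hFs, hlim⟩).trans ?_
  refine (liminf_le_liminf (Eventually.of_forall fun n => (hFe n).trans
    (mul_le_mul' le_rfl (hr n).1.le))).trans_eq ?_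
  exact liminf_const _

/-! ### Sobolev approximants with explicit constants -/

section UpperBound

variable {X : Type*} [MetricSpace X] [ConnectedSpace X] [SecondCountableTopology X]
  [MeasurableSpace X] [BorelSpace X] {m : Measure X} {ι : X → ℝ} {ι₀ r₀ : ℝ} {Φ : ℝ → ℝ}
  {α C₀ c₁ C₁ : ℝ} {N : ℕ}

theorem exists_mem_sobolevSpace (htree : ∀ x, IsRealTree (ball x (ι x)))
    (hdiam : ENNReal.ofReal ι₀ ≤ ediam (univ : Set X)) (hι : ∀ x, ι₀ ≤ ι x)
    (hΦpos : ∀ r, 0 < r → r ≤ r₀ → 0 < Φ r) (hC₀ : 0 < C₀)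
    (hΦ : ∀ r R, 0 < r → r ≤ R → R ≤ r₀ → Φ R / Φ r ≤ C₀ * (R / r) ^ α)
    (hc₁ : 0 < c₁) (hC₁ : 0 < C₁)
    (hvol : ∀ (x : X) (r : ℝ), 0 < r → r < r₀ →
      ENNReal.ofReal (c₁ * Φ r) ≤ m (ball x r) ∧ m (ball x r) ≤ ENNReal.ofReal (C₁ * Φ r))
    (hN : C₁ * (C₀ * 14 ^ α) / c₁ ≤ N) {r : ℝ} (hr : 0 < r) (hrι : r < ι₀) (hr₀ : 2 * r < r₀)
    (f : Lp ℝ 1 m) (hE : ksEnergy m Φ 1 f r ≠ ∞) :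
    ∃ F ∈ sobolevSpace m ι,
      energyOne m ι F ≤
        ENNReal.ofReal (6 * N ^ 5 * ((C₀ * 6 ^ α / c₁) ^ 2 * C₁)) * ksEnergy m Φ 1 f r ∧
      edist F f ≤ ENNReal.ofReal (N * (C₀ * 6 ^ α / c₁ * C₁ * Φ r)) * ksEnergy m Φ 1 f r := by
  set E := ksEnergy m Φ 1 f r with hEdef
  set K := C₀ * 6 ^ α / c₁ with hK
  have hK0 : 0 < K := by positivity
  -- Chosen so that the double integral at radius 6ε is the one at radius r. The constant 6 ^ α
  -- compares Φ(r) with Φ(ε), and 14 ^ α compares Φ(7ε) with Φ(ε/2) in the packing bound; 2r < r₀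
  -- keeps 7ε below r₀.
  set ε := r / 6 with hε
  have hε0 : 0 < ε := by positivity
  have h6ε : 6 * ε = r := by rw [hε]; ring
  have hΦr := hΦpos r hr (by linarith)
  have hΦε := hΦpos ε hε0 (by linarith)
  have hb0 : ENNReal.ofReal (c₁ * Φ ε) ≠ 0 := by
    rw [Ne, ENNReal.ofReal_eq_zero, not_le]; positivity
  have hM0 : ENNReal.ofReal (C₁ * Φ r) ≠ 0 := by
    rw [Ne, ENNReal.ofReal_eq_zero, not_le]; positivity
  have hpack : ∀ (x : X) (s : Finset X), (∀ u ∈ s, dist u x < 6 * ε) →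
      (∀ u ∈ s, ∀ v ∈ s, u ≠ v → ε ≤ dist u v) → s.card ≤ N := by
    intro x s
    have hΦε2 := hΦpos (ε / 2) (by linarith) (by linarith)
    refine card_le_of_measure_ball (m := m) (a := ENNReal.ofReal (c₁ * Φ (ε / 2)))
      (b := ENNReal.ofReal (C₁ * Φ (7 * ε))) ?_ ENNReal.ofReal_ne_top
      (fun y => (hvol y _ (by linarith) (by linarith)).1)
      (fun y => (hvol y _ (by linarith) (by linarith)).2) ?_ hε0 s
    · rw [Ne, ENNReal.ofReal_eq_zero, not_le]; positivity
    · rw [← ENNReal.ofReal_natCast N, ← ENNReal.ofReal_mul (Nat.cast_nonneg N)]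
      refine ENNReal.ofReal_le_ofReal ?_
      have h1 := hΦ (ε / 2) (7 * ε) (by linarith) (by linarith) (by linarith)
      rw [show 7 * ε / (ε / 2) = 14 by field_simp; norm_num, div_le_iff₀ hΦε2] at h1
      rw [div_le_iff₀ hc₁] at hN
      calc C₁ * Φ (7 * ε) ≤ C₁ * (C₀ * 14 ^ α * Φ (ε / 2)) := by gcongr
        _ = C₁ * (C₀ * 14 ^ α) * Φ (ε / 2) := by ring
        _ ≤ N * c₁ * Φ (ε / 2) := by gcongr
        _ = _ := by ring
  have hJ : pairEnergy m f r ≤ ENNReal.ofReal (C₁ * Φ r ^ 2) * E := by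
    have h := le_ksEnergy_one (Φ := Φ) f hM0 fun x => (hvol x r hr (by linarith)).2
    rw [← ENNReal.ofReal_inv_of_pos hΦr, ← ENNReal.ofReal_inv_of_pos (by positivity), ← mul_assoc,
      ← ENNReal.ofReal_mul (by positivity)] at h
    calc pairEnergy m f r = ENNReal.ofReal (C₁ * Φ r ^ 2) *
          (ENNReal.ofReal ((Φ r)⁻¹ * (C₁ * Φ r)⁻¹) * pairEnergy m f r) := by
          rw [← mul_assoc, ← ENNReal.ofReal_mul (by positivity),
            show C₁ * Φ r ^ 2 * ((Φ r)⁻¹ * (C₁ * Φ r)⁻¹) = 1 by field_simp, ENNReal.ofReal_one,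
            one_mul]
      _ ≤ _ := by gcongr
  have hbinv : (ENNReal.ofReal (c₁ * Φ ε))⁻¹ ≤ ENNReal.ofReal (K / Φ r) := by
    rw [← ENNReal.ofReal_inv_of_pos (by positivity)]
    refine ENNReal.ofReal_le_ofReal ?_
    have h1 := hΦ ε r hε0 (by linarith) (by linarith)
    rw [show r / ε = 6 by rw [hε]; field_simp, div_le_iff₀ hΦε] at h1
    rw [inv_eq_one_div, div_le_div_iff₀ (by positivity) hΦr, one_mul]
    calc Φ r ≤ C₀ * 6 ^ α * Φ ε := h1
      _ = K * (c₁ * Φ ε) := by rw [hK]; field_simp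
  obtain ⟨F, hF, ⟨h, hh, hhint⟩, hL1⟩ := exists_approximation htree hε0
    (fun x => by linarith [hι x])
    (fun x => shell_nonempty (isTreeSet_of_isRealTree (htree x)) hε0 (by linarith [hι x])
      (((ENNReal.ofReal_lt_ofReal_iff (by linarith)).2 (by linarith)).trans_le hdiam)) hpack hb0
    (fun x => (hvol x ε hε0 (by linarith)).1)
    (fun x => ((hvol x ε hε0 (by linarith)).2.trans_lt ENNReal.ofReal_lt_top).ne)
    (memLp_one_iff_integrable.1 (Lp.memLp f))
  rw [h6ε] at hhint hL1
  have hhint' : ∫⁻ z, ‖h z‖ₑ ∂lengthMeasure ι ≤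
      ENNReal.ofReal (6 * N ^ 5 * (K ^ 2 * C₁)) * E := by
    refine hhint.trans ?_
    calc 6 * (N : ℝ≥0∞) ^ 5 * ((ENNReal.ofReal (c₁ * Φ ε))⁻¹ * (ENNReal.ofReal (c₁ * Φ ε))⁻¹ *
          pairEnergy m f r)
        ≤ 6 * (N : ℝ≥0∞) ^ 5 * (ENNReal.ofReal (K / Φ r) * ENNReal.ofReal (K / Φ r) *
          (ENNReal.ofReal (C₁ * Φ r ^ 2) * E)) := by gcongr
      _ = 6 * (N : ℝ≥0∞) ^ 5 * (ENNReal.ofReal (K ^ 2 * C₁) * E) := by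
          rw [← mul_assoc (_ * _) (ENNReal.ofReal _) E, ← ENNReal.ofReal_mul (by positivity),
            ← ENNReal.ofReal_mul (by positivity)]
          congr 3
          field_simp
      _ = _ := by
          rw [ENNReal.ofReal_mul (p := 6 * (N : ℝ) ^ 5) (by positivity),
            ENNReal.ofReal_mul (p := 6) (by norm_num), ENNReal.ofReal_pow (Nat.cast_nonneg N),
            ENNReal.ofReal_natCast, ← mul_assoc]
          norm_num
  have hL1' : ∫⁻ x, ‖F x - f x‖ₑ ∂m ≤ ENNReal.ofReal (N * (K * C₁ * Φ r)) * E := by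
    refine hL1.trans ?_
    calc (N : ℝ≥0∞) * ((ENNReal.ofReal (c₁ * Φ ε))⁻¹ * pairEnergy m f r)
        ≤ N * (ENNReal.ofReal (K / Φ r) * (ENNReal.ofReal (C₁ * Φ r ^ 2) * E)) := by gcongr
      _ = N * (ENNReal.ofReal (K * C₁ * Φ r) * E) := by
          rw [← mul_assoc (ENNReal.ofReal _) (ENNReal.ofReal _) E,
            ← ENNReal.ofReal_mul (by positivity)]
          congr 3
          field_simp
      _ = _ := by
          rw [ENNReal.ofReal_mul (p := (N : ℝ)) (Nat.cast_nonneg N), ENNReal.ofReal_natCast,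
            mul_assoc (N : ℝ≥0∞)]
  -- Integrability of F is deduced from that of F - f, which the finite energy provides.
  have hdiff : MemLp (fun x => F x - f x) 1 m := by
    rw [memLp_one_iff_integrable]
    exact ⟨hF.1.aestronglyMeasurable.sub (Lp.aestronglyMeasurable f),
      hL1'.trans_lt (ENNReal.mul_lt_top ENNReal.ofReal_lt_top (lt_top_iff_ne_top.2 hE))⟩
  have hFL : MemLp F 1 m := by
    have := hdiff.add (Lp.memLp f)
    refine this.ae_eq (Eventually.of_forall fun x => ?_)
    simp
  have hae : F =ᵐ[m] hFL.toLp F := hFL.coeFn_toLp.symm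
  refine ⟨hFL.toLp F, ⟨F, hae, hF, h, hh, ?_⟩, ?_, ?_⟩
  · rw [memLp_one_iff_integrable]
    exact ⟨hh.1,
      hhint'.trans_lt (ENNReal.mul_lt_top ENNReal.ofReal_lt_top (lt_top_iff_ne_top.2 hE))⟩
  · exact (iInf₂_le_of_le F ⟨hae, hF⟩ (iInf₂_le h hh)).trans hhint'
  · rw [L1.edist_def]
    refine (lintegral_congr_ae ?_).trans_le hL1'
    filter_upwards [hae] with x hx
    rw [← hx, edist_eq_enorm_sub]

end UpperBound

end LocalTree

end

/-! ### The theorem -/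

theorem theorem3p8 {X : Type*} [MetricSpace X] [LocallyCompactSpace X] [ConnectedSpace X]
    [TopologicalSpace.SeparableSpace X] [MeasurableSpace X] [BorelSpace X]
    -- a Radon measure with full support
    (m : Measure X) [IsLocallyFiniteMeasure m] [m.IsOpenPosMeasure]
    -- `X` is a uniform local tree
    (ι : X → ℝ) (htree : ∀ x, LocalTree.IsRealTree (ball x (ι x)))
    (ι₀ : ℝ) (hι₀ : 0 < ι₀) (hdiam : ENNReal.ofReal ι₀ ≤ ediam (univ : Set X))
    (hι : ∀ x, ι₀ ≤ ι x)
    -- the volume function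
    (r₀ : ℝ) (hr₀ : 0 < r₀) (Φ : ℝ → ℝ) (hΦ_nonneg : ∀ r ∈ Icc 0 r₀, 0 ≤ Φ r)
    (hΦ_mono : MonotoneOn Φ (Icc 0 r₀))
    (α : ℝ) (hα : 1 ≤ α) (c₀ C₀ : ℝ) (hc₀ : 0 < c₀) (hC₀ : 0 < C₀)
    (hΦ : ∀ r R, 0 < r → r ≤ R → R ≤ r₀ →
      c₀ * (R / r) ≤ Φ R / Φ r ∧ Φ R / Φ r ≤ C₀ * (R / r) ^ α)
    -- uniform volume control
    (c₁ C₁ : ℝ) (hc₁ : 0 < c₁) (hC₁ : 0 < C₁)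
    (hvol : ∀ (x : X) (r : ℝ), 0 < r → r < r₀ →
      ENNReal.ofReal (c₁ * Φ r) ≤ m (ball x r) ∧ m (ball x r) ≤ ENNReal.ofReal (C₁ * Φ r)) :
    LocalTree.KSSpace m Φ = LocalTree.BVSpace m ι ∧
      ∃ c C r₁ : ℝ, 0 < c ∧ 0 < C ∧ 0 < r₁ ∧ r₁ ≤ r₀ ∧
        ∀ f ∈ LocalTree.KSSpace m Φ,
          ENNReal.ofReal c * (⨆ r ∈ Ioc 0 r₁, LocalTree.ksEnergy m Φ 1 f r) ≤
              LocalTree.totalVariation m ι f ∧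
            LocalTree.totalVariation m ι f ≤
              ENNReal.ofReal C * liminf (fun r => LocalTree.ksEnergy m Φ 1 f r) (𝓝[>] 0) := by
  have : SecondCountableTopology X := UniformSpace.secondCountable_of_separable X
  have hΦpos : ∀ r, 0 < r → r ≤ r₀ → 0 < Φ r := fun r =>
    LocalTree.volumeFunction_pos hΦ_nonneg hc₀ hΦ
  obtain ⟨N, hN⟩ := exists_nat_ge (C₁ * (C₀ * 14 ^ α) / c₁)
  have hN0 : (0 : ℝ) < N := lt_of_lt_of_le (by positivity) hN
  -- Below ι₀ all pairs considered lie in a common tree ball and shells are nonempty; below r₀ / 2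
  -- the slightly larger balls of the packing argument still have controlled volume.
  set δ := min ι₀ (r₀ / 2) with hδ
  have hδ0 : 0 < δ := lt_min hι₀ (by linarith)
  set C := 6 * (N : ℝ) ^ 5 * ((C₀ * 6 ^ α / c₁) ^ 2 * C₁) with hC
  have hC0 : 0 < C := by positivity
  have hupper : ∀ f : Lp ℝ 1 m, LocalTree.totalVariation m ι f ≤
      ENNReal.ofReal C * liminf (fun r => LocalTree.ksEnergy m Φ 1 f r) (𝓝[>] 0) := by
    refine LocalTree.totalVariation_le_liminf_ksEnergy (A := N * (C₀ * 6 ^ α / c₁ * C₁)) hC0 hδ0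
      (LocalTree.tendsto_volumeFunction hΦ_nonneg hr₀ hc₀ hΦ) fun f r hr hrδ hE => ?_
    obtain ⟨F, hF, h1, h2⟩ := LocalTree.exists_mem_sobolevSpace htree hdiam hι hΦpos hC₀
      (fun r R h h' h'' => (hΦ r R h h' h'').2) hc₁ hC₁ hvol hN hr
      (hrδ.trans_le (min_le_left _ _)) (by linarith [min_le_right ι₀ (r₀ / 2)]) f hE
    exact ⟨F, hF, h1, by rwa [← mul_assoc] at h2⟩
  have hlower : ∀ f : Lp ℝ 1 m, ∀ r ∈ Ioc 0 δ, LocalTree.ksEnergy m Φ 1 f r ≤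
      ENNReal.ofReal (C₁ ^ 2 / c₁) * LocalTree.totalVariation m ι f := by
    intro f r hr
    have hrr₀ : r < r₀ := by linarith [hr.2, min_le_right ι₀ (r₀ / 2)]
    exact LocalTree.ksEnergy_le_totalVariation hc₁ hC₁ (hΦpos r hr.1 hrr₀.le)
      (fun x => (hr.2.trans (min_le_left _ _)).trans (hι x)) (fun x => hvol x r hr.1 hrr₀) f
  refine ⟨Subset.antisymm (fun f hf => ?_) (fun f hf => ?_), c₁ / C₁ ^ 2, C, δ, by positivity,
    hC0, hδ0, (min_le_right _ _).trans (by linarith), fun f _ => ⟨?_, hupper f⟩⟩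
  · exact (hupper f).trans_lt (ENNReal.mul_lt_top ENNReal.ofReal_lt_top
      (lt_of_le_of_lt liminf_le_limsup hf))
  · have hle : limsup (fun r => LocalTree.ksEnergy m Φ 1 f r) (𝓝[>] 0) ≤
        ENNReal.ofReal (C₁ ^ 2 / c₁) * LocalTree.totalVariation m ι f :=
      limsup_le_of_le (by isBoundedDefault) (by
        filter_upwards [Ioc_mem_nhdsGT hδ0] with r hr using hlower f r hr)
    exact hle.trans_lt (ENNReal.mul_lt_top ENNReal.ofReal_lt_top hf)
  · calc ENNReal.ofReal (c₁ / C₁ ^ 2) * ⨆ r ∈ Ioc 0 δ, LocalTree.ksEnergy m Φ 1 f r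
        ≤ ENNReal.ofReal (c₁ / C₁ ^ 2) *
          (ENNReal.ofReal (C₁ ^ 2 / c₁) * LocalTree.totalVariation m ι f) := by
          gcongr
          exact iSup₂_le (hlower f)
      _ = LocalTree.totalVariation m ι f := by
          rw [← mul_assoc, ← ENNReal.ofReal_mul (by positivity),
            show c₁ / C₁ ^ 2 * (C₁ ^ 2 / c₁) = 1 by field_simp, ENNReal.ofReal_one, one_mul]
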